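/- Let $M$ be a smooth manifold of dimension $p+q$ and let $F$ be a smooth transversely oriented foliation of $M$ of dimension $p$ and codimension $q$ (for instance, $M$ and $F$ oriented). Suppose $F$ is transversely affine: $M$ is covered by foliation charts whose changes of transverse coordinates are locally given by (orientation preserving) affine maps of $\mathbb{R}^q$. Let $T$ be a transversal contained in one of these charts, on which the transverse coordinates $x=(x_1,\dots,x_q)$ of the chart form a coordinate system. Let $G_T$ be the restriction to $T$ of the holonomy groupoid of $F$, whose arrows are the leafwise paths with end points in $T$, two paths with the same source being identified when they have the same holonomy germ; in the coordinates $x$ these germs are germs of affine maps, and $G_T$ is an étale groupoid over $T$. Let $\delta(\gamma)=\frac{d\gamma}{dx}>0$ be the Jacobian determinant of the holonomy $\gamma\in G_T$, and let $G_T^u=\{\gamma\in G_T : \delta(\gamma)=1\}$ be the unimodular part. Let $G_T\rtimes\mathbb{R}$ be the étale groupoid with objects $T\times\mathbb{R}$, arrows $G_T\times\mathbb{R}$, source $s(\gamma,t)=(s\gamma,t)$ and range $r(\gamma,t)=(r\gamma,t+\log\delta(\gamma))$, and let $C_c^\infty(G_T\rtimes\mathbb{R})$ be its convolution algebra of smooth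 compactly supported complex functions. Put $$\psi(f^0,\dots,f^q)=\int_{\mathbb{R}}dt\int_{\gamma_0\cdots\gamma_q\in T\times\{t\}} f^0(\gamma_0)\,df^1(\gamma_1)\wedge\cdots\wedge df^q(\gamma_q),$$ where the differentials are taken in the direction of $T$ only, and are pulled back along the groupoid to the point $\gamma_0\cdots\gamma_q$ of $T\times\{t\}$. Suppose that $G_T^u$ acts ergodically on $T$: every Borel subset of $T$ that is invariant under $G_T^u$ is null or conull for the Lebesgue measure $dx$. Then $\psi$ is an anabelian cyclic $q$-cocycle on $\mathcal{A}=C_c^\infty(G_T\rtimes\mathbb{R})$. That is, $\psi$ is a cyclic $q$-cocycle, and for every element $g$ of the centre of the multiplier algebra $M(\mathcal{A})$ (the algebra of double centralizers of $\mathcal{A}$) the functional $$\psi_g(f^0,f^1,\dots,f^q)=\psi(g f^0,f^1,\dots,f^q)$$ is again a cyclic $q$-cocycle on $\mathcal{A}$. Here a cyclic $q$-cocycle is a $(q+1)$-linear functional $\varphi$ with $\varphi(f^1,\dots,f^q,f^0)=(-1)^q\varphi(f^0,\dots,f^q)$ and $\sum_{j=0}^{q}(-1)^j\varphi(f^0,\dots,f^jf^{j+1},\dots,f^{q+1})+(-1)^{q+1}\varphi(f^{q+1}f^0,f^1,\dots,f^q)=0$.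 -/

import Mathlib

open scoped Manifold ContDiff Topology

noncomputable section

namespace TransAffine

/-! ## Cyclic cocycles, multipliers, anabelian cocycles -/

section Cyclic

variable {A : Type*} [NonUnitalRing A] [Module ℂ A]

/-- A cyclic `k`-cocycle on a complex algebra: a `(k+1)`-linear functional `φ` with
`φ(f¹, …, fᵏ, f⁰) = (-1)ᵏ φ(f⁰, …, fᵏ)` and vanishing Hochschild coboundary
`∑_{j ≤ k} (-1)ʲ φ(…, fʲ fʲ⁺¹, …) + (-1)ᵏ⁺¹ φ(fᵏ⁺¹ f⁰, f¹, …, fᵏ) = 0`. -/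
structure IsCyclicCocycle {k : ℕ} (φ : (Fin (k + 1) → A) → ℂ) : Prop where
  multilinear : ∃ m : MultilinearMap ℂ (fun _ : Fin (k + 1) => A) ℂ, ∀ f, m f = φ f
  cyclic : ∀ f : Fin (k + 1) → A, φ (fun i => f (i + 1)) = (-1) ^ k * φ f
  hochschild : ∀ f : Fin (k + 2) → A,
    (∑ j : Fin (k + 1), (-1) ^ (j : ℕ) * φ (j.castSucc.contractNth (· * ·) f))
      + (-1) ^ (k + 1) * φ (Function.update (Fin.init f) 0 (f (Fin.last (k + 1)) * f 0)) = 0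

variable (A) in
/-- A multiplier (double centralizer) of a complex algebra `A`: `left a` stands for `m a` and
`right a` stands for `a m`. -/
@[ext]
structure Multiplier where
  left : A →ₗ[ℂ] A
  right : A →ₗ[ℂ] A
  left_mul : ∀ a b, left (a * b) = left a * b
  right_mul : ∀ a b, right (a * b) = a * right b
  middle : ∀ a b, a * left b = right a * b

instance : Mul (Multiplier A) where
  mul m n :=
    { left := m.left ∘ₗ n.left
      right := n.right ∘ₗ m.right
      left_mul := fun a b => by simp [n.left_mul, m.left_mul]
      right_mul := fun a b => by simp [n.right_mul, m.right_mul]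
      middle := fun a b => by simp [m.middle, n.middle] }

/-- The functional `φ_g : (f⁰, …, fᵏ) ↦ φ(g f⁰, f¹, …, fᵏ)`. -/
def twist {k : ℕ} (φ : (Fin (k + 1) → A) → ℂ) (g : Multiplier A) : (Fin (k + 1) → A) → ℂ :=
  fun f => φ (Function.update f 0 (g.left (f 0)))

/-- A cyclic cocycle `φ` on `A` is anabelian when `φ_g` is again a cyclic cocycle for every `g` in
the centre of the multiplier algebra of `A`. -/
structure IsAnabelian {k : ℕ} (φ : (Fin (k + 1) → A) → ℂ) : Prop where
  isCyclicCocycle : IsCyclicCocycle φ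
  twist : ∀ g ∈ Set.center (Multiplier A), IsCyclicCocycle (twist φ g)

end Cyclic

/-! ## Étale groupoids of germs of affine maps -/

/-- The affine group of `ℝ^q`; its multiplication is composition of maps. -/
abbrev Aff (q : ℕ) := EuclideanSpace ℝ (Fin q) ≃ᵃ[ℝ] EuclideanSpace ℝ (Fin q)

/-- `|det|` of the linear part: the Radon–Nikodym derivative of the volume form of `ℝ^q` under an
affine map. -/
def Aff.delta {q : ℕ} (A : Aff q) : ℝ :=
  |LinearMap.det (A.linear : EuclideanSpace ℝ (Fin q) →ₗ[ℝ] EuclideanSpace ℝ (Fin q))|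

/-- The action of an affine map on `ℝ^q × ℝ`: `(x, t) ↦ (A x, t + log δ(A))`. -/
def Aff.shift {q : ℕ} (A : Aff q) (z : EuclideanSpace ℝ (Fin q) × ℝ) :
    EuclideanSpace ℝ (Fin q) × ℝ :=
  (A z.1, z.2 + Real.log A.delta)

lemma Aff.delta_pos {q : ℕ} (A : Aff q) : 0 < A.delta :=
  abs_pos.2 (LinearEquiv.isUnit_det' A.linear).ne_zero

lemma Aff.delta_mul {q : ℕ} (A B : Aff q) : (A * B).delta = A.delta * B.delta := by
  unfold Aff.delta
  rw [← abs_mul, ← LinearMap.det_comp]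
  rfl

lemma Aff.shift_mul {q : ℕ} (A B : Aff q) (z : EuclideanSpace ℝ (Fin q) × ℝ) :
    (A * B).shift z = A.shift (B.shift z) := by
  unfold Aff.shift
  rw [Aff.delta_mul, Real.log_mul A.delta_pos.ne' B.delta_pos.ne']
  ext1
  · rfl
  · simp only
    ring

lemma Aff.contDiff {q : ℕ} (A : Aff q) : ContDiff ℝ ∞ (fun x => A x) :=
  A.toContinuousAffineEquiv.toContinuousAffineMap.contDiff

lemma Aff.shift_contDiff {q : ℕ} (A : Aff q) : ContDiff ℝ ∞ A.shift :=
  (A.contDiff.comp contDiff_fst).prodMk (contDiff_snd.add contDiff_const)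

/-- An étale groupoid of germs of affine maps between open pieces of an open set `base ⊆ ℝ^q`.
The pair `(A, x)` stands for the germ at `x` of the affine map `A`, an arrow with source `x` and
range `A x`; the product is `(B, A x) (A, x) = (B A, x)`. The topology is the germ topology, that
is, the one induced from (discrete affine group) × `ℝ^q`. -/
structure AffineGroupoid (q : ℕ) where
  base : Set (EuclideanSpace ℝ (Fin q))
  arrows : Set (Aff q × EuclideanSpace ℝ (Fin q))
  isOpen_base : IsOpen base
  source_mem : ∀ {A x}, (A, x) ∈ arrows → x ∈ base
  range_mem : ∀ {A x}, (A, x) ∈ arrows → A x ∈ base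
  isOpen_arrows : ∀ A, IsOpen {x | (A, x) ∈ arrows}
  one_mem : ∀ {x}, x ∈ base → (1, x) ∈ arrows
  inv_mem : ∀ {A x}, (A, x) ∈ arrows → (A⁻¹, A x) ∈ arrows
  mul_mem : ∀ {A B x}, (A, x) ∈ arrows → (B, A x) ∈ arrows → (B * A, x) ∈ arrows

namespace AffineGroupoid

variable {q : ℕ} (G : AffineGroupoid q)

/-- The unimodular part (the arrows with `δ = 1`) acts ergodically on the base with respect to the
Lebesgue measure class: invariant Borel sets are null or conull. -/
def UnimodularErgodic : Prop :=
  ∀ B : Set (EuclideanSpace ℝ (Fin q)), MeasurableSet B → B ⊆ G.base →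
    (∀ A x, (A, x) ∈ G.arrows → A.delta = 1 → (x ∈ B ↔ A x ∈ B)) →
    MeasureTheory.volume B = 0 ∨ MeasureTheory.volume (G.base \ B) = 0

/-- The part of `G ⋊ ℝ` carried by the affine map `A`, as an open subset of `ℝ^q × ℝ`.
The arrows of `G ⋊ ℝ` are the `((A, x), t)` with `(A, x)` an arrow of `G`; such an arrow has source
`(x, t)` and range `(A x, t + log δ(A))`. -/
def sheet (A : Aff q) : Set (EuclideanSpace ℝ (Fin q) × ℝ) := {z | (A, z.1) ∈ G.arrows}

/-- Smooth complex functions on `ℝ^q × ℝ` with compact support contained in the set `U`. -/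
def testFunctions (U : Set (EuclideanSpace ℝ (Fin q) × ℝ)) :
    Submodule ℂ (EuclideanSpace ℝ (Fin q) × ℝ → ℂ) where
  carrier := {u | ContDiff ℝ ∞ u ∧ HasCompactSupport u ∧ tsupport u ⊆ U}
  zero_mem' := ⟨contDiff_const, HasCompactSupport.zero, by simp [tsupport]⟩
  add_mem' := fun {u v} hu hv => ⟨hu.1.add hv.1, hu.2.1.add hv.2.1,
    (tsupport_add u v).trans (Set.union_subset hu.2.2 hv.2.2)⟩
  smul_mem' := fun c u hu => ⟨contDiff_const.smul hu.1, hu.2.1.smul_left (f := fun _ => c),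
    (tsupport_smul_subset_right (fun _ => c) u).trans hu.2.2⟩

/-- The space `C_c^∞(G ⋊ ℝ)`. As a manifold `G ⋊ ℝ` is the disjoint union over `A` of the open sets
`G.sheet A`, so an element is a finitely supported family of test functions `f A` on the sheets
(each extended by zero to `ℝ^q × ℝ`): `f A (x, t)` is the value at the arrow `((A, x), t)`. -/
def smoothFunctions : Submodule ℂ (Aff q → EuclideanSpace ℝ (Fin q) × ℝ → ℂ) where
  carrier := {f | (∀ A, f A ∈ testFunctions (G.sheet A)) ∧ (Function.support f).Finite}
  zero_mem' := ⟨fun _ => zero_mem _, by simp⟩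
  add_mem' := fun {f g} hf hg => ⟨fun A => add_mem (hf.1 A) (hg.1 A),
    (hf.2.union hg.2).subset (Function.support_add f g)⟩
  smul_mem' := fun c f hf => ⟨fun A => Submodule.smul_mem _ c (hf.1 A),
    hf.2.subset (Function.support_const_smul_subset c f)⟩

/-- Convolution `(f * g)(γ) = ∑_{γ₁ γ₂ = γ} f(γ₁) g(γ₂)` on `G ⋊ ℝ`: for `γ = ((A, x), t)` one has
`γ₂ = ((C, x), t)` and `γ₁ = ((A C⁻¹, C x), t + log δ(C))`. -/
def conv (f g : Aff q → EuclideanSpace ℝ (Fin q) × ℝ → ℂ) :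
    Aff q → EuclideanSpace ℝ (Fin q) × ℝ → ℂ :=
  fun A z => ∑ᶠ C : Aff q, f (A * C⁻¹) (C.shift z) * g C z

lemma conv_eq_sum {f g : Aff q → EuclideanSpace ℝ (Fin q) × ℝ → ℂ} {s : Finset (Aff q)}
    (hs : ∀ C, C ∉ s → g C = 0) (A : Aff q) (z : EuclideanSpace ℝ (Fin q) × ℝ) :
    conv f g A z = ∑ C ∈ s, f (A * C⁻¹) (C.shift z) * g C z := by
  refine finsum_eq_sum_of_support_subset _ fun C hC => ?_
  by_contra h
  exact hC (by simp [hs C h])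

lemma exists_finset {f : Aff q → EuclideanSpace ℝ (Fin q) × ℝ → ℂ} (hf : f ∈ G.smoothFunctions) :
    ∃ s : Finset (Aff q), ∀ C, C ∉ s → f C = 0 :=
  ⟨hf.2.toFinset, fun C hC => by simpa using hC⟩

lemma conv_mem {f g : Aff q → EuclideanSpace ℝ (Fin q) × ℝ → ℂ}
    (hf : f ∈ G.smoothFunctions) (hg : g ∈ G.smoothFunctions) : conv f g ∈ G.smoothFunctions := by
  refine ⟨fun A => ?_, ?_⟩
  · obtain ⟨s, hs⟩ := G.exists_finset hg
    have : conv f g A = ∑ C ∈ s, fun z => f (A * C⁻¹) (C.shift z) * g C z := by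
      funext z
      rw [conv_eq_sum hs, Finset.sum_apply]
    rw [this]
    refine Submodule.sum_mem _ fun C _ => ?_
    have hfC := hf.1 (A * C⁻¹)
    have hgC := hg.1 C
    refine ⟨(hfC.1.comp C.shift_contDiff).mul hgC.1, hgC.2.1.mul_left, fun z hz => ?_⟩
    have h1 : (C, z.1) ∈ G.arrows := hgC.2.2 (tsupport_mul_subset_right hz)
    have h2 : C.shift z ∈ tsupport (f (A * C⁻¹)) :=
      tsupport_comp_subset_preimage (f (A * C⁻¹)) C.shift_contDiff.continuous
        (tsupport_mul_subset_left (f := fun z => f (A * C⁻¹) (C.shift z)) hz)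
    have h3 : (A * C⁻¹, C z.1) ∈ G.arrows := hfC.2.2 h2
    simpa [sheet] using G.mul_mem h1 h3
  · refine (Set.Finite.image2 (· * ·) hf.2 hg.2).subset fun A hA => ?_
    by_contra h
    refine hA (funext fun z => finsum_eq_zero_of_forall_eq_zero fun C => ?_)
    by_contra h0
    exact h ⟨A * C⁻¹, fun h1 => h0 (by simp [h1]), C, fun h1 => h0 (by simp [h1]), by simp⟩

lemma conv_assoc {f g h : Aff q → EuclideanSpace ℝ (Fin q) × ℝ → ℂ}
    (hg : g ∈ G.smoothFunctions) (hh : h ∈ G.smoothFunctions) :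
    conv (conv f g) h = conv f (conv g h) := by
  classical
  obtain ⟨s, hs⟩ := G.exists_finset hg
  obtain ⟨r, hr⟩ := G.exists_finset hh
  obtain ⟨w, hw⟩ := G.exists_finset (G.conv_mem hg hh)
  funext A z
  let u : Finset (Aff q) := w ∪ Finset.image₂ (· * ·) s r
  have hu : ∀ C, C ∉ u → conv g h C = 0 := fun C hC =>
    hw C fun h => hC (Finset.mem_union_left _ h)
  rw [conv_eq_sum hr, conv_eq_sum hu]
  simp_rw [conv_eq_sum hs, conv_eq_sum hr, Finset.sum_mul, Finset.mul_sum]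
  rw [Finset.sum_comm (s := u)]
  refine Finset.sum_congr rfl fun C hC => ?_
  have key : ∀ D ∈ s, D * C ∈ u := fun D hD =>
    Finset.mem_union_right _ (Finset.mem_image₂_of_mem hD hC)
  refine Finset.sum_of_injOn (fun D => D * C) (fun D _ E _ hDE => mul_right_cancel hDE)
    (fun D hD => key D hD) (fun E _ hE => ?_) (fun D _ => ?_)
  · have : g (E * C⁻¹) = 0 := hs _ fun h => hE ⟨E * C⁻¹, h, by simp⟩
    simp [this]
  · simp [Aff.shift_mul, mul_assoc]

/-- The convolution algebra `C_c^∞(G ⋊ ℝ)`. -/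
def Algebra : Type := G.smoothFunctions

instance : AddCommGroup G.Algebra := inferInstanceAs (AddCommGroup G.smoothFunctions)

instance : Module ℂ G.Algebra := inferInstanceAs (Module ℂ G.smoothFunctions)

/-- The value of `f` at the arrow `((A, x), t)` is `f.val A (x, t)`. -/
def Algebra.val {G : AffineGroupoid q} (f : G.Algebra) :
    Aff q → EuclideanSpace ℝ (Fin q) × ℝ → ℂ := Subtype.val (p := (· ∈ G.smoothFunctions)) f

lemma Algebra.val_mem {G : AffineGroupoid q} (f : G.Algebra) : f.val ∈ G.smoothFunctions :=
  Subtype.property (p := (· ∈ G.smoothFunctions)) f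

lemma Algebra.val_injective {G : AffineGroupoid q} :
    Function.Injective (Algebra.val : G.Algebra → _) := Subtype.val_injective

instance : Mul G.Algebra where
  mul f g := (⟨conv f.val g.val, G.conv_mem f.val_mem g.val_mem⟩ : G.smoothFunctions)

lemma Algebra.val_mul {G : AffineGroupoid q} (f g : G.Algebra) :
    (f * g).val = conv f.val g.val := rfl

lemma Algebra.val_add {G : AffineGroupoid q} (f g : G.Algebra) :
    (f + g).val = f.val + g.val := rfl

lemma Algebra.val_zero {G : AffineGroupoid q} : (0 : G.Algebra).val = 0 := rfl

lemma Algebra.val_smul {G : AffineGroupoid q} (c : ℂ) (f : G.Algebra) :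
    (c • f).val = c • f.val := rfl

instance : NonUnitalRing G.Algebra where
  left_distrib a b c := Algebra.val_injective <| by
    obtain ⟨s, hs⟩ := G.exists_finset b.val_mem
    obtain ⟨r, hr⟩ := G.exists_finset c.val_mem
    classical
    have h1 : ∀ C, C ∉ s ∪ r → b.val C = 0 := fun C hC => hs C fun h => hC (by simp [h])
    have h2 : ∀ C, C ∉ s ∪ r → c.val C = 0 := fun C hC => hr C fun h => hC (by simp [h])
    have h3 : ∀ C, C ∉ s ∪ r → (b.val + c.val) C = 0 := fun C hC => by simp [h1 C hC, h2 C hC]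
    simp only [Algebra.val_add, Algebra.val_mul]
    funext A z
    rw [Pi.add_apply, Pi.add_apply, conv_eq_sum h1, conv_eq_sum h2, conv_eq_sum h3,
      ← Finset.sum_add_distrib]
    exact Finset.sum_congr rfl fun C _ => mul_add _ _ _
  right_distrib a b c := Algebra.val_injective <| by
    obtain ⟨s, hs⟩ := G.exists_finset c.val_mem
    simp only [Algebra.val_add, Algebra.val_mul]
    funext A z
    rw [Pi.add_apply, Pi.add_apply, conv_eq_sum hs, conv_eq_sum hs, conv_eq_sum hs,
      ← Finset.sum_add_distrib]
    exact Finset.sum_congr rfl fun C _ => add_mul _ _ _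
  zero_mul a := Algebra.val_injective <| by
    funext A z
    simp [Algebra.val_mul, Algebra.val_zero, conv]
  mul_zero a := Algebra.val_injective <| by
    funext A z
    simp [Algebra.val_mul, Algebra.val_zero, conv]
  mul_assoc a b c := Algebra.val_injective <| by
    simp only [Algebra.val_mul]
    exact G.conv_assoc b.val_mem c.val_mem

instance : IsScalarTower ℂ G.Algebra G.Algebra where
  smul_assoc c f g := Algebra.val_injective <| by
    obtain ⟨s, hs⟩ := G.exists_finset g.val_mem
    funext A z
    simp only [smul_eq_mul, Algebra.val_mul, Algebra.val_smul, Pi.smul_apply]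
    rw [conv_eq_sum hs, conv_eq_sum hs, Finset.mul_sum]
    exact Finset.sum_congr rfl fun C _ => by simp [mul_assoc]

instance : SMulCommClass ℂ G.Algebra G.Algebra where
  smul_comm c f g := Algebra.val_injective <| by
    obtain ⟨s, hs⟩ := G.exists_finset g.val_mem
    have hs' : ∀ C, C ∉ s → (c • g.val) C = 0 := fun C hC => by simp [hs C hC]
    funext A z
    simp only [smul_eq_mul, Algebra.val_mul, Algebra.val_smul, Pi.smul_apply]
    rw [conv_eq_sum hs, conv_eq_sum hs', Finset.mul_sum]
    exact Finset.sum_congr rfl fun C _ => by simp; ring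

/-- For `γ = (γ₀, …, γ_q)` with `γ₀ ⋯ γ_q` the unit at `(x, t)` and `γ_j` carried by the affine map
`a j`, the source of `γ_j` is `(a_{j+1} ⋯ a_q) . (x, t)`; this is the affine map `a_{j+1} ⋯ a_q`. -/
def tail (a : Fin (q + 1) → Aff q) (j : Fin (q + 1)) : Aff q :=
  ((List.ofFn a).drop (j + 1)).prod

/-- The function `x ↦ fʲ(γ_j)` near `x`, where `γ_j` is the arrow carried by `a j` with source
`(a_{j+1} ⋯ a_q) . (x, t)`. -/
def pullback {G : AffineGroupoid q} (f : Fin (q + 1) → G.Algebra) (a : Fin (q + 1) → Aff q)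
    (t : ℝ) (j : Fin (q + 1)) (x : EuclideanSpace ℝ (Fin q)) : ℂ :=
  (f j).val (a j) ((tail a j).shift (x, t))

/-- The coefficient of `dx₁ ∧ ⋯ ∧ dx_q` at `(x, t)` in the `q`-form
`f⁰(γ₀) df¹(γ₁) ∧ ⋯ ∧ df^q(γ_q)`, the differentials being taken along `T × {t}` and pulled back to
the unit `γ₀ ⋯ γ_q = (x, t)`; here `γ_j` is carried by `a j`. -/
def formCoeff {G : AffineGroupoid q} (f : Fin (q + 1) → G.Algebra) (a : Fin (q + 1) → Aff q)
    (t : ℝ) (x : EuclideanSpace ℝ (Fin q)) : ℂ :=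
  pullback f a t 0 x *
    (Matrix.of fun j i : Fin q =>
      fderiv ℝ (pullback f a t j.succ) x (EuclideanSpace.single i 1)).det

/-- The functional
`ψ(f⁰, …, f^q) = ∫_ℝ dt ∫_{γ₀ ⋯ γ_q ∈ T × {t}} f⁰(γ₀) df¹(γ₁) ∧ ⋯ ∧ df^q(γ_q)`
on `C_c^∞(G ⋊ ℝ)`. The integration over `{γ₀ ⋯ γ_q ∈ T × {t}}` is the integral over `x ∈ T` of
the sum over all `(γ₀, …, γ_q)` whose product is the unit at `(x, t)`. -/
def psi (f : Fin (q + 1) → G.Algebra) : ℂ :=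
  ∫ t : ℝ, ∫ x in G.base,
    ∑ᶠ a : {a : Fin (q + 1) → Aff q // (List.ofFn a).prod = 1}, formCoeff f a.1 t x

end AffineGroupoid

/-! ## Transversely affine foliations and their holonomy -/

section Foliations

variable (p q : ℕ) (M : Type*) [TopologicalSpace M]
  [ChartedSpace (EuclideanSpace ℝ (Fin (p + q))) M]

/-- Local charts of `M` with values in `ℝ^p × ℝ^q`: leaf direction and transverse direction. -/
abbrev ProductChart :=
  OpenPartialHomeomorph M (EuclideanSpace ℝ (Fin p) × EuclideanSpace ℝ (Fin q))

variable {p q M}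

/-- The chart `e` and its inverse are smooth for the given smooth structure of `M`. -/
def ProductChart.IsSmooth (e : ProductChart p q M) : Prop :=
  ContMDiffOn (𝓡 (p + q)) 𝓘(ℝ, EuclideanSpace ℝ (Fin p) × EuclideanSpace ℝ (Fin q)) ∞ e e.source ∧
  ContMDiffOn 𝓘(ℝ, EuclideanSpace ℝ (Fin p) × EuclideanSpace ℝ (Fin q)) (𝓡 (p + q)) ∞
    e.symm e.target

/-- The change of charts from `e` to `e'` locally maps plaques to plaques: locally, the transverse
coordinate of `e'` is a function of the transverse coordinate of `e`. -/
def ProductChart.Compatible (e e' : ProductChart p q M) : Prop :=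
  ∀ m ∈ e.source ∩ e'.source, ∃ h : EuclideanSpace ℝ (Fin q) → EuclideanSpace ℝ (Fin q),
    ∀ᶠ m' in 𝓝 m, (e' m').2 = h (e m').2

variable (p q M) in
/-- A smooth foliation of dimension `p` and codimension `q`, given by a foliated atlas. -/
structure Foliation where
  charts : Set (ProductChart p q M)
  smooth : ∀ e ∈ charts, e.IsSmooth
  cover : ∀ m : M, ∃ e ∈ charts, m ∈ e.source
  compatible : ∀ e ∈ charts, ∀ e' ∈ charts, e.Compatible e'

namespace Foliation

variable (F : Foliation p q M)

/-- The foliation charts of `F`: the members of its maximal foliated atlas. -/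
structure IsFoliationChart (e : ProductChart p q M) : Prop where
  smooth : e.IsSmooth
  compatible : ∀ e' ∈ F.charts, e.Compatible e' ∧ e'.Compatible e

/-- A covering of `M` by foliation charts with respect to which the holonomy maps are orientation
preserving affine maps. A transversely oriented foliation is transversely affine when such a
covering exists. -/
structure AffineAtlas where
  charts : Set (ProductChart p q M)
  isFoliationChart : ∀ e ∈ charts, F.IsFoliationChart e
  cover : ∀ m : M, ∃ e ∈ charts, m ∈ e.source
  affine : ∀ e ∈ charts, ∀ e' ∈ charts, ∀ m ∈ e.source ∩ e'.source, ∃ A : Aff q,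
    0 < LinearMap.det (A.linear : EuclideanSpace ℝ (Fin q) →ₗ[ℝ] EuclideanSpace ℝ (Fin q)) ∧
      ∀ᶠ m' in 𝓝 m, (e' m').2 = A (e m').2

/-- `c`, restricted to `[0, 1]`, moves inside a leaf: its transverse coordinate is locally constant
in every chart of `F`. -/
def IsLeafwise (c : ℝ → M) : Prop :=
  ∀ s ∈ Set.Icc (0 : ℝ) 1, ∀ e ∈ F.charts, c s ∈ e.source →
    ∀ᶠ s' in 𝓝[Set.Icc (0 : ℝ) 1] s, (e (c s')).2 = (e (c s)).2

variable {F}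

lemma isLeafwise_const (m : M) : F.IsLeafwise (fun _ => m) :=
  fun _ _ _ _ _ => Filter.Eventually.of_forall fun _ => rfl

lemma IsLeafwise.reverse {c : ℝ → M} (hc : F.IsLeafwise c) :
    F.IsLeafwise (fun s => c (1 - s)) := by
  intro s hs e he hes
  have ht : Filter.Tendsto (fun s : ℝ => 1 - s) (𝓝[Set.Icc (0 : ℝ) 1] s)
      (𝓝[Set.Icc (0 : ℝ) 1] (1 - s)) :=
    tendsto_nhdsWithin_iff.2 ⟨(Continuous.tendsto (by fun_prop) s).mono_left nhdsWithin_le_nhds,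
      eventually_nhdsWithin_of_forall fun r hr => ⟨by linarith [hr.2], by linarith [hr.1]⟩⟩
  exact ht.eventually (hc (1 - s) ⟨by linarith [hs.2], by linarith [hs.1]⟩ e he hes)

lemma IsLeafwise.trans {c d : ℝ → M} (hc : F.IsLeafwise c) (hd : F.IsLeafwise d)
    (hcd : c 1 = d 0) :
    F.IsLeafwise (fun s => if s ≤ 1 / 2 then c (2 * s) else d (2 * s - 1)) := by
  intro s hs e he hes
  have h1 : ∀ᶠ s' in 𝓝[Set.Icc (0 : ℝ) 1] s, s' ≤ 1 / 2 →
      (e (c (2 * s'))).2 = (e (if s ≤ 1 / 2 then c (2 * s) else d (2 * s - 1))).2 := by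
    rcases le_or_gt s (1 / 2) with h | h
    · simp only [h, if_true] at hes ⊢
      have ht : Filter.Tendsto (fun s : ℝ => 2 * s) (𝓝[Set.Icc (0 : ℝ) 1 ∩ Set.Iic (1 / 2)] s)
          (𝓝[Set.Icc (0 : ℝ) 1] (2 * s)) :=
        tendsto_nhdsWithin_iff.2 ⟨(Continuous.tendsto (by fun_prop) s).mono_left
          nhdsWithin_le_nhds, eventually_nhdsWithin_of_forall fun r hr =>
            ⟨by linarith [hr.1.1], by linarith [Set.mem_Iic.1 hr.2]⟩⟩
      have := ht.eventually (hc (2 * s) ⟨by linarith [hs.1], by linarith⟩ e he hes)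
      rwa [nhdsWithin_inter', Filter.eventually_inf_principal] at this
    · filter_upwards [nhdsWithin_le_nhds (lt_mem_nhds h)] with r hr hr'
      exact absurd hr (not_lt.2 hr')
  have h2 : ∀ᶠ s' in 𝓝[Set.Icc (0 : ℝ) 1] s, 1 / 2 ≤ s' →
      (e (d (2 * s' - 1))).2 = (e (if s ≤ 1 / 2 then c (2 * s) else d (2 * s - 1))).2 := by
    rcases le_or_gt (1 / 2) s with h | h
    · have hcs : (if s ≤ 1 / 2 then c (2 * s) else d (2 * s - 1)) = d (2 * s - 1) := by
        split_ifs with h'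
        · have : s = 1 / 2 := le_antisymm h' h
          subst this
          norm_num [hcd]
        · rfl
      simp only [hcs] at hes ⊢
      have ht : Filter.Tendsto (fun s : ℝ => 2 * s - 1)
          (𝓝[Set.Icc (0 : ℝ) 1 ∩ Set.Ici (1 / 2)] s) (𝓝[Set.Icc (0 : ℝ) 1] (2 * s - 1)) :=
        tendsto_nhdsWithin_iff.2 ⟨(Continuous.tendsto (by fun_prop) s).mono_left
          nhdsWithin_le_nhds, eventually_nhdsWithin_of_forall fun r hr =>
            ⟨by linarith [Set.mem_Ici.1 hr.2], by linarith [hr.1.2]⟩⟩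
      have := ht.eventually (hd (2 * s - 1) ⟨by linarith, by linarith [hs.2]⟩ e he hes)
      rwa [nhdsWithin_inter', Filter.eventually_inf_principal] at this
    · filter_upwards [nhdsWithin_le_nhds (gt_mem_nhds h)] with r hr hr'
      exact absurd hr (not_lt.2 hr')
  filter_upwards [h1, h2] with r hr1 hr2
  rcases le_or_gt r (1 / 2) with h | h
  · rw [← hr1 h]
    simp only [h, if_true]
  · rw [← hr2 h.le]
    simp only [not_le.2 h, if_false]

/-- A transversal `T` contained in one chart of an affine atlas on which the transverse coordinates
`x = (x₁, …, x_q)` of the chart form a coordinate system. `T` is identified with the open set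
`base = x(T)`; the embedding of `T` into `M` is `emb`, the inverse of `x`. -/
structure Transversal (𝒰 : F.AffineAtlas) where
  chart : ProductChart p q M
  chart_mem : chart ∈ 𝒰.charts
  base : Set (EuclideanSpace ℝ (Fin q))
  isOpen_base : IsOpen base
  emb : EuclideanSpace ℝ (Fin q) → M
  smooth_emb : ContMDiffOn 𝓘(ℝ, EuclideanSpace ℝ (Fin q)) (𝓡 (p + q)) ∞ emb base
  emb_mem : ∀ x ∈ base, emb x ∈ chart.source
  chart_emb : ∀ x ∈ base, (chart (emb x)).2 = x

namespace Transversal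

variable {𝒰 : F.AffineAtlas} (T : Transversal 𝒰)

/-- The germ of `h` at `x` is the holonomy germ `T → T` of some leafwise path `H x` starting at the
point `x` of `T`: the path extends to a continuous family of leafwise paths `H y`, for `y` in a
neighbourhood `U` of `x` in `T`, running from the point `y` to the point `h y` of `T`. -/
def IsHolonomyGerm (h : EuclideanSpace ℝ (Fin q) → EuclideanSpace ℝ (Fin q))
    (x : EuclideanSpace ℝ (Fin q)) : Prop :=
  ∃ (U : Set (EuclideanSpace ℝ (Fin q))) (H : EuclideanSpace ℝ (Fin q) → ℝ → M),
    IsOpen U ∧ x ∈ U ∧ U ⊆ T.base ∧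
    ContinuousOn (Function.uncurry H) (U ×ˢ Set.Icc (0 : ℝ) 1) ∧
    ∀ y ∈ U, F.IsLeafwise (H y) ∧ H y 0 = T.emb y ∧ h y ∈ T.base ∧ H y 1 = T.emb (h y)

variable {T}

lemma IsHolonomyGerm.one {x : EuclideanSpace ℝ (Fin q)} (hx : x ∈ T.base) :
    T.IsHolonomyGerm (1 : Aff q) x :=
  ⟨T.base, fun y _ => T.emb y, T.isOpen_base, hx, subset_rfl,
    T.smooth_emb.continuousOn.comp continuousOn_fst fun _ hz => hz.1,
    fun _ hy => ⟨isLeafwise_const _, rfl, hy, rfl⟩⟩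

lemma IsHolonomyGerm.inv {A : Aff q} {x : EuclideanSpace ℝ (Fin q)}
    (hA : T.IsHolonomyGerm A x) : T.IsHolonomyGerm (A⁻¹ : Aff q) (A x) := by
  obtain ⟨U, H, hU, hx, hUT, hH, h⟩ := hA
  have hinv : ∀ y, A ((A⁻¹ : Aff q) y) = y := fun y => A.apply_symm_apply y
  refine ⟨(A⁻¹ : Aff q) ⁻¹' U, fun y s => H ((A⁻¹ : Aff q) y) (1 - s),
    hU.preimage (A⁻¹ : Aff q).contDiff.continuous, ?_, fun y hy => ?_, ?_, fun y hy => ?_⟩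
  · exact (show A.symm (A x) ∈ U by simpa using hx)
  · simpa [hinv] using (h _ hy).2.2.1
  · refine hH.comp (f := fun z : EuclideanSpace ℝ (Fin q) × ℝ => ((A⁻¹ : Aff q) z.1, 1 - z.2))
      (Continuous.continuousOn ?_) fun z hz => ⟨hz.1, ?_, ?_⟩
    · exact ((A⁻¹ : Aff q).contDiff.continuous.comp continuous_fst).prodMk (by fun_prop)
    · linarith [hz.2.2]
    · linarith [hz.2.1]
  · obtain ⟨h1, h2, h3, h4⟩ := h _ hy
    exact ⟨h1.reverse, by simp [h4, hinv], hUT hy, by simp [h2]⟩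

lemma IsHolonomyGerm.mul {A B : Aff q} {x : EuclideanSpace ℝ (Fin q)}
    (hA : T.IsHolonomyGerm A x) (hB : T.IsHolonomyGerm B (A x)) :
    T.IsHolonomyGerm (B * A : Aff q) x := by
  obtain ⟨U, H, hU, hx, hUT, hH, h⟩ := hA
  obtain ⟨V, K, hV, hy, hVT, hK, k⟩ := hB
  refine ⟨U ∩ A ⁻¹' V, fun y s => if s ≤ 1 / 2 then H y (2 * s) else K (A y) (2 * s - 1),
    hU.inter (hV.preimage A.contDiff.continuous), ⟨hx, hy⟩, fun y hy => hUT hy.1, ?_,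
    fun y hy => ?_⟩
  · refine ContinuousOn.if (p := fun z : EuclideanSpace ℝ (Fin q) × ℝ => z.2 ≤ 1 / 2)
      (f := fun z => H z.1 (2 * z.2)) (g := fun z => K (A z.1) (2 * z.2 - 1)) ?_ ?_ ?_
    · rintro ⟨y, s⟩ ⟨⟨hy, -⟩, hs⟩
      have hs' : s = 1 / 2 := frontier_le_subset_eq continuous_snd continuous_const hs
      subst hs'
      norm_num [(h y hy.1).2.2.2, (k (A y) hy.2).2.1]
    · refine hH.comp (f := fun z : EuclideanSpace ℝ (Fin q) × ℝ => (z.1, 2 * z.2))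
        (Continuous.continuousOn (by fun_prop)) fun z hz => ⟨hz.1.1.1, ?_, ?_⟩
      · linarith [hz.1.2.1]
      · have : z.2 ≤ 1 / 2 := 
          (isClosed_le (f := fun z : EuclideanSpace ℝ (Fin q) × ℝ => z.2)
            continuous_snd continuous_const).closure_subset hz.2
        linarith
    · refine hK.comp (f := fun z : EuclideanSpace ℝ (Fin q) × ℝ => (A z.1, 2 * z.2 - 1))
        (Continuous.continuousOn ?_) fun z hz => ⟨hz.1.1.2, ?_, ?_⟩
      · exact (A.contDiff.continuous.comp continuous_fst).prodMk (by fun_prop)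
      · have : 1 / 2 ≤ z.2 := closure_lt_subset_le continuous_const continuous_snd
          (by simpa only [not_le] using hz.2)
        linarith
      · linarith [hz.1.2.2]
  · obtain ⟨h1, h2, h3, h4⟩ := h y hy.1
    obtain ⟨k1, k2, k3, k4⟩ := k (A y) hy.2
    refine ⟨h1.trans k1 (h4.trans k2.symm), by simpa using h2, k3, ?_⟩
    norm_num [k4]

/-- Every holonomy germ is the germ of an (orientation preserving) affine map. -/
lemma IsHolonomyGerm.exists_affine {h : EuclideanSpace ℝ (Fin q) → EuclideanSpace ℝ (Fin q)}
    {x : EuclideanSpace ℝ (Fin q)} (hh : T.IsHolonomyGerm h x) : ∃ A : Aff q,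
    0 < LinearMap.det (A.linear : EuclideanSpace ℝ (Fin q) →ₗ[ℝ] EuclideanSpace ℝ (Fin q)) ∧
      h =ᶠ[𝓝 x] A := by
  obtain ⟨U, H, hU, hx, hUT, hH, hh⟩ := hh
  let Q : ProductChart p q M → ℝ → Prop := fun e s => ∃ A : Aff q,
    0 < LinearMap.det (A.linear : EuclideanSpace ℝ (Fin q) →ₗ[ℝ] EuclideanSpace ℝ (Fin q)) ∧
      ∀ᶠ y in 𝓝 x, (e (H y s)).2 = A y
  have hchart : ∀ s ∈ Set.Icc (0 : ℝ) 1, ∀ e ∈ 𝒰.charts, ∀ e' ∈ 𝒰.charts,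
      H x s ∈ e.source → H x s ∈ e'.source → Q e s → Q e' s := by
    rintro s hs e he e' he' hes hes' ⟨A, hA, hAe⟩
    obtain ⟨B, hB, hBe⟩ := 𝒰.affine e he e' he' (H x s) ⟨hes, hes'⟩
    have hc : ContinuousAt (fun y => H y s) x :=
      (hH.comp (f := fun y => (y, s)) (Continuous.continuousOn (by fun_prop))
        (fun y (hy : y ∈ U) => ⟨hy, hs⟩)).continuousAt (hU.mem_nhds hx)
    refine ⟨B * A, ?_, ?_⟩
    · have := mul_pos hB hA
      rwa [← LinearMap.det_comp] at this
    · filter_upwards [hAe, hc.eventually hBe] with y h1 h2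
      rw [h2, h1]
      rfl
  have hleaf : ∀ y ∈ U, ∀ s ∈ Set.Icc (0 : ℝ) 1, ∀ e ∈ 𝒰.charts, H y s ∈ e.source →
      ∀ᶠ s' in 𝓝[Set.Icc (0 : ℝ) 1] s, (e (H y s')).2 = (e (H y s)).2 := by
    intro y hy s hs e he hes
    obtain ⟨e', he', hes'⟩ := F.cover (H y s)
    obtain ⟨k, hk⟩ := ((𝒰.isFoliationChart e he).compatible e' he').2 (H y s) ⟨hes', hes⟩
    have hc : ContinuousWithinAt (fun s => H y s) (Set.Icc (0 : ℝ) 1) s :=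
      (hH.comp (f := fun s => (y, s)) (Continuous.continuousOn (by fun_prop))
        (fun s' hs' => ⟨hy, hs'⟩)) s hs
    filter_upwards [hc.eventually hk, (hh y hy).1 s hs e' he' hes'] with s' h1 h2
    rw [h1, h2, hk.self_of_nhds]
  let P : ℝ → Prop := fun s => ∀ e ∈ 𝒰.charts, H x s ∈ e.source → Q e s
  have hloc : ∀ s ∈ Set.Icc (0 : ℝ) 1, ∀ᶠ s' in 𝓝[Set.Icc (0 : ℝ) 1] s, P s ↔ P s' := by
    intro s hs
    obtain ⟨e, he, hes⟩ := 𝒰.cover (H x s)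
    have hc := hH (x, s) ⟨hx, hs⟩
    have hev := hc.preimage_mem_nhdsWithin (e.open_source.mem_nhds hes)
    rw [nhdsWithin_prod_eq, hU.nhdsWithin_eq hx] at hev
    obtain ⟨W, hW, I, hI, hWI⟩ := Filter.mem_prod_iff.1 hev
    obtain ⟨ε, hε, hεI⟩ := Metric.mem_nhdsWithin_iff.1 hI
    have hpre : IsPreconnected (Metric.ball s ε ∩ Set.Icc (0 : ℝ) 1) :=
      ((convex_ball s ε).inter (convex_Icc 0 1)).isPreconnected
    have hconst : ∀ s' ∈ Metric.ball s ε ∩ Set.Icc (0 : ℝ) 1, ∀ y ∈ W ∩ U,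
        (e (H y s)).2 = (e (H y s')).2 := by
      intro s' hs' y hy
      refine hpre.induction₂ (fun a b => (e (H y a)).2 = (e (H y b)).2) (fun a ha => ?_)
        (fun _ _ _ _ _ _ h1 h2 => h1.trans h2) (fun _ _ _ _ h1 => h1.symm)
        ⟨Metric.mem_ball_self hε, hs⟩ hs'
      have hsrc : H y a ∈ e.source := hWI (Set.mk_mem_prod hy.1 (hεI ha))
      filter_upwards [nhdsWithin_mono a Set.inter_subset_right
        (hleaf y hy.2 a ha.2 e he hsrc)] with b hb
      exact hb.symm
    have hball : Metric.ball s ε ∩ Set.Icc (0 : ℝ) 1 ∈ 𝓝[Set.Icc (0 : ℝ) 1] s :=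
      Filter.inter_mem (nhdsWithin_le_nhds (Metric.ball_mem_nhds s hε)) self_mem_nhdsWithin
    filter_upwards [hball] with s' hs'
    have hes' : H x s' ∈ e.source := hWI (Set.mk_mem_prod (mem_of_mem_nhds hW) (hεI hs'))
    have hWU : W ∩ U ∈ 𝓝 x := Filter.inter_mem hW (hU.mem_nhds hx)
    have hQ : Q e s ↔ Q e s' := by
      constructor
      · rintro ⟨A, hA, hAe⟩
        refine ⟨A, hA, ?_⟩
        filter_upwards [hAe, hWU] with y h1 h2
        rw [← hconst s' hs' y h2, h1]
      · rintro ⟨A, hA, hAe⟩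
        refine ⟨A, hA, ?_⟩
        filter_upwards [hAe, hWU] with y h1 h2
        rw [hconst s' hs' y h2, h1]
    exact ⟨fun hP e' he' h' => hchart s' hs'.2 e he e' he' hes' h' (hQ.1 (hP e he hes)),
      fun hP e' he' h' => hchart s hs e he e' he' hes h' (hQ.2 (hP e he hes'))⟩
  have h01 : P 0 ↔ P 1 :=
    isPreconnected_Icc.induction₂ (fun a b => P a ↔ P b) hloc
      (fun _ _ _ _ _ _ h1 h2 => h1.trans h2) (fun _ _ _ _ h1 => h1.symm)
      (Set.left_mem_Icc.2 zero_le_one) (Set.right_mem_Icc.2 zero_le_one)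
  have hP0 : P 0 := by
    intro e he hes
    have hsrc : H x 0 ∈ T.chart.source := by
      rw [(hh x hx).2.1]
      exact T.emb_mem x (hUT hx)
    refine hchart 0 (Set.left_mem_Icc.2 zero_le_one) T.chart T.chart_mem e he hsrc hes
      ⟨1, ?_, ?_⟩
    · have : ((1 : Aff q).linear : EuclideanSpace ℝ (Fin q) →ₗ[ℝ] EuclideanSpace ℝ (Fin q))
          = LinearMap.id := rfl
      rw [this, LinearMap.det_id]
      exact one_pos
    · filter_upwards [hU.mem_nhds hx] with y hy
      rw [(hh y hy).2.1, T.chart_emb y (hUT hy)]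
      rfl
  obtain ⟨A, hA, hAe⟩ := h01.1 hP0 T.chart T.chart_mem (by
    rw [(hh x hx).2.2.2]
    exact T.emb_mem _ (hh x hx).2.2.1)
  refine ⟨A, hA, ?_⟩
  filter_upwards [hAe, hU.mem_nhds hx] with y h1 h2
  rw [← h1, (hh y h2).2.2.2, T.chart_emb _ (hh y h2).2.2.1]

variable (T)

/-- The restriction `G_T` of the holonomy groupoid of the foliation to the transversal `T`. Two
leafwise paths with end points in `T` define the same arrow when they have the same source and the
same holonomy germ; the holonomy germs are germs of affine maps because the foliation is
transversely affine. -/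
def groupoid : AffineGroupoid q where
  base := T.base
  arrows := {a | T.IsHolonomyGerm a.1 a.2}
  isOpen_base := T.isOpen_base
  source_mem := fun ⟨_, _, _, hx, hU, _⟩ => hU hx
  range_mem := fun ⟨_, _, _, hx, _, _, h⟩ => (h _ hx).2.2.1
  isOpen_arrows _ := isOpen_iff_forall_mem_open.2 fun _ ⟨U, H, hU, hx, hUT, hH, h⟩ =>
    ⟨U, fun _ hy => ⟨U, H, hU, hy, hUT, hH, h⟩, hU, hx⟩
  one_mem := IsHolonomyGerm.one
  inv_mem := IsHolonomyGerm.inv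
  mul_mem := IsHolonomyGerm.mul

end Transversal

end Foliation

end Foliations

end TransAffine

end

/-!
The functional `ψ` is the character of a closed graded trace on the crossed product of `G ⋊ ℝ` with
the differential forms along `T`. More generally let `η : ℝ → ℂ` be continuous and invariant under
the translations `t ↦ t + log δ(γ)`, and let `ψ_η` (`weightedPsi`) be `ψ` with `dt` replaced by
`η(t) dt`. Every `ψ_η` is a cyclic `q`-cocycle (`isCyclicCocycle_weightedPsi`):

* Reading off the functions `fʲ` along a path `γ₀ ⋯ γ_q` of arrows with product the unit at `(x, t)`
  writes `ψ_η(f⁰, …, f^q)` as a finite sum of integrals `∫ η(t) dt ∫ v₀ dv₁ ∧ ⋯ ∧ dv_q` of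
  compactly supported smooth functions on `ℝ^q × ℝ` (`pathFunction`, `sliceIntegral`).
* These integrals do not change under the action of an affine map of positive determinant
  (`sliceIntegral_comp_shift`): since `log δ` is locally constant on the groupoid, the action
  commutes with the differential along `T`.
* They are cyclic up to the sign `(-1)^q`, by Stokes' theorem (`integral_topForm_rotate`), and they
  satisfy the Hochschild identity, by the Leibniz rule (`hochschild_topForm`).

A multiplier `g` in the centre acts as multiplication by a continuous invariant function `h` on the
objects `T × ℝ` of `G ⋊ ℝ` (`exists_central_function`). Indeed `g` commutes with the functions on
the objects, so it maps them to functions carried by the isotropy. A nontrivial affine germ has no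
interior fixed points, so the isotropy contributes nothing outside the units. For each `t` the
function `h(·, t)` is invariant under the unimodular part of the groupoid, so ergodicity makes it a
constant `η(t)` (`UnimodularErgodic.exists_weight`). The invariance of `h` under the full groupoid
says that `η` is invariant under the translations by `log δ(γ)`; hence `ψ_g = ψ_η` is a cyclic
cocycle. The case `η = 1` is `ψ` itself.
-/

noncomputable section

namespace TransAffine

open MeasureTheory

/-! ### Test functions and top-degree forms -/

/-- Smooth complex functions with compact support. -/
structure IsTest {E : Type*} [NormedAddCommGroup E] [NormedSpace ℝ E] (u : E → ℂ) : Prop where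
  contDiff : ContDiff ℝ ∞ u
  hasCompactSupport : HasCompactSupport u

namespace IsTest

variable {E F : Type*} [NormedAddCommGroup E] [NormedSpace ℝ E] [NormedAddCommGroup F]
  [NormedSpace ℝ F] {u v : E → ℂ}

lemma mul (hu : IsTest u) (hv : IsTest v) : IsTest (fun x => u x * v x) :=
  ⟨hu.1.mul hv.1, hu.2.mul_right⟩

lemma differentiable (hu : IsTest u) : Differentiable ℝ u :=
  hu.1.differentiable (by simp)

lemma contDiff_fderiv_apply (hu : IsTest u) (e : E) : ContDiff ℝ ∞ fun x => fderiv ℝ u x e :=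
  (hu.1.fderiv_right (m := ∞) (by simp)).clm_apply contDiff_const

lemma fderiv_apply (hu : IsTest u) (e : E) : IsTest fun x => fderiv ℝ u x e :=
  ⟨hu.contDiff_fderiv_apply e, hu.2.fderiv_apply (𝕜 := ℝ) e⟩

lemma slice {u : E × F → ℂ} (hu : IsTest u) (t : F) : IsTest fun x => u (x, t) :=
  ⟨hu.1.comp (contDiff_id.prodMk contDiff_const),
    hu.2.comp_isClosedEmbedding (g := fun x => (x, t))
      ⟨⟨Topology.IsInducing.of_comp (by fun_prop) continuous_fst Topology.IsInducing.id,
        fun _ _ h => (Prod.mk.inj h).1⟩, by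
        rw [show Set.range (fun x : E => (x, t)) = Prod.snd ⁻¹' {t} by
          ext ⟨a, b⟩; simp [eq_comm]]
        exact isClosed_singleton.preimage continuous_snd⟩⟩

/-- Partial differentiation along the first factor. -/
lemma fderiv_slice {u : E × F → ℂ} (hu : IsTest u) (x : E) (t : F) (e : E) :
    fderiv ℝ (fun x => u (x, t)) x e = fderiv ℝ u (x, t) (e, 0) := by
  have h : HasFDerivAt (fun x => (x, t)) ((ContinuousLinearMap.id ℝ E).prod (0 : E →L[ℝ] F)) x :=
    (hasFDerivAt_id x).prodMk (hasFDerivAt_const t x)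
  have h' : HasFDerivAt (fun x => u (x, t)) _ x :=
    HasFDerivAt.comp x (hu.differentiable (x, t)).hasFDerivAt h
  rw [h'.fderiv]
  simp

end IsTest

variable {q : ℕ}

/-- The matrix of partial derivatives `∂ᵢ wⱼ (x)`, one row for each function `wⱼ`. -/
def gradMatrix {m : ℕ} (w : Fin m → EuclideanSpace ℝ (Fin q) → ℂ) (x : EuclideanSpace ℝ (Fin q)) :
    Matrix (Fin m) (Fin q) ℂ :=
  Matrix.of fun j i => fderiv ℝ (w j) x (EuclideanSpace.single i 1)

/-- The coefficient of `dx₁ ∧ ⋯ ∧ dx_q` in the form `w₀ dw₁ ∧ ⋯ ∧ dw_q`. -/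
def topForm (w : Fin (q + 1) → EuclideanSpace ℝ (Fin q) → ℂ) (x : EuclideanSpace ℝ (Fin q)) : ℂ :=
  w 0 x * (gradMatrix (fun j => w j.succ) x).det

lemma gradMatrix_update {m : ℕ} (w : Fin m → EuclideanSpace ℝ (Fin q) → ℂ)
    (x : EuclideanSpace ℝ (Fin q)) (k : Fin m) (u : EuclideanSpace ℝ (Fin q) → ℂ) :
    gradMatrix (Function.update w k u) x =
      (gradMatrix w x).updateRow k fun i => fderiv ℝ u x (EuclideanSpace.single i 1) := by
  ext j i
  by_cases h : j = k
  · subst h; simp [gradMatrix]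
  · simp [gradMatrix, h]

lemma update_succ_zero {α : Type*} {m : ℕ} (w : Fin (m + 1) → α) (u : α) :
    (fun j : Fin m => Function.update w 0 u j.succ) = fun j => w j.succ := by
  funext j; simp

lemma update_succ_succ {α : Type*} {m : ℕ} (w : Fin (m + 1) → α) (k : Fin m) (u : α) :
    (fun j : Fin m => Function.update w k.succ u j.succ) =
      Function.update (fun j => w j.succ) k u := by
  funext j
  by_cases h : j = k
  · subst h; simp
  · simp [h]

lemma topForm_update_succ (w : Fin (q + 1) → EuclideanSpace ℝ (Fin q) → ℂ) (k : Fin q)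
    (u : EuclideanSpace ℝ (Fin q) → ℂ) (x : EuclideanSpace ℝ (Fin q)) :
    topForm (Function.update w k.succ u) x = w 0 x *
      ((gradMatrix (fun j => w j.succ) x).updateRow k
        fun i => fderiv ℝ u x (EuclideanSpace.single i 1)).det := by
  rw [topForm, update_succ_succ, gradMatrix_update,
    Function.update_of_ne (Fin.succ_ne_zero k).symm]

lemma topForm_update_add (w : Fin (q + 1) → EuclideanSpace ℝ (Fin q) → ℂ) (k : Fin (q + 1))
    {u v : EuclideanSpace ℝ (Fin q) → ℂ} {x : EuclideanSpace ℝ (Fin q)}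
    (hu : DifferentiableAt ℝ u x) (hv : DifferentiableAt ℝ v x) :
    topForm (Function.update w k (u + v)) x =
      topForm (Function.update w k u) x + topForm (Function.update w k v) x := by
  cases k using Fin.cases with
  | zero => simp only [topForm, update_succ_zero, Function.update_self, Pi.add_apply, add_mul]
  | succ k =>
    rw [topForm_update_succ, topForm_update_succ, topForm_update_succ, ← mul_add,
      ← Matrix.det_updateRow_add, fderiv_add hu hv]
    rfl

lemma topForm_update_smul (w : Fin (q + 1) → EuclideanSpace ℝ (Fin q) → ℂ) (k : Fin (q + 1))
    (c : ℂ) {u : EuclideanSpace ℝ (Fin q) → ℂ} {x : EuclideanSpace ℝ (Fin q)}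
    (hu : DifferentiableAt ℝ u x) :
    topForm (Function.update w k (c • u)) x = c * topForm (Function.update w k u) x := by
  cases k using Fin.cases with
  | zero =>
    simp only [topForm, update_succ_zero, Function.update_self, Pi.smul_apply, smul_eq_mul,
      mul_assoc]
  | succ k =>
    rw [topForm_update_succ, topForm_update_succ, mul_left_comm, ← Matrix.det_updateRow_smul _ k c,
      fderiv_const_smul hu]
    rfl

lemma topForm_eq_zero {w : Fin (q + 1) → EuclideanSpace ℝ (Fin q) → ℂ} {k : Fin (q + 1)}
    (hk : w k = 0) (x : EuclideanSpace ℝ (Fin q)) : topForm w x = 0 := by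
  have h := topForm_update_smul w k 0 (u := 0) (x := x) (differentiableAt_const _)
  rw [smul_zero, zero_mul] at h
  rwa [← hk, Function.update_eq_self] at h

/-! ### Stokes' theorem and cyclic symmetry -/

lemma sum_sign_mul_eq_zero {n : Type*} [Fintype n] [DecidableEq n] {i j : n} (hij : i ≠ j)
    (T : Equiv.Perm n → ℂ) (hT : ∀ σ, T (σ * Equiv.swap i j) = T σ) :
    ∑ σ : Equiv.Perm n, ((Equiv.Perm.sign σ : ℤ) : ℂ) * T σ = 0 := by
  have h := Equiv.sum_comp (Equiv.mulRight (Equiv.swap i j))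
    fun σ : Equiv.Perm n => ((Equiv.Perm.sign σ : ℤ) : ℂ) * T σ
  simp only [Equiv.coe_mulRight, hT, Equiv.Perm.sign_mul, Equiv.Perm.sign_swap hij] at h
  simp only [mul_neg, mul_one, Units.val_neg, Int.cast_neg, neg_mul, Finset.sum_neg_distrib] at h
  exact CharZero.neg_eq_self_iff.1 h

lemma IsTest.fderiv_fderiv_comm {u : EuclideanSpace ℝ (Fin q) → ℂ} (hu : IsTest u)
    (x e e' : EuclideanSpace ℝ (Fin q)) :
    fderiv ℝ (fun y => fderiv ℝ u y e) x e' = fderiv ℝ (fun y => fderiv ℝ u y e') x e := by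
  have hd : DifferentiableAt ℝ (fderiv ℝ u) x :=
    (hu.1.fderiv_right (m := ∞) (by simp)).differentiable (by simp) x
  have h := (hu.1.contDiffAt (x := x)).isSymmSndFDerivAt
    (by simpa using WithTop.coe_le_coe.2 (le_top : (2 : ℕ∞) ≤ ⊤))
  rw [fderiv_clm_apply hd (differentiableAt_const _),
    fderiv_clm_apply hd (differentiableAt_const _)]
  simpa using (h e' e)

/-- Stokes' theorem: the exact form `dw₀ ∧ dw₁ ∧ ⋯ ∧ dwₙ` on `ℝⁿ⁺¹` has integral zero. In the
Leibniz expansion of the determinant each term is integrated by parts with respect to `w₀`; the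
second derivatives that appear are symmetric, so they cancel against the sign of the permutation. -/
lemma integral_det_gradMatrix {n : ℕ} {w : Fin (n + 1) → EuclideanSpace ℝ (Fin (n + 1)) → ℂ}
    (hw : ∀ j, IsTest (w j)) : ∫ x, (gradMatrix w x).det = 0 := by
  let e : Fin (n + 1) → EuclideanSpace ℝ (Fin (n + 1)) := fun i => EuclideanSpace.single i 1
  let P : Equiv.Perm (Fin (n + 1)) → EuclideanSpace ℝ (Fin (n + 1)) → ℂ := fun σ x =>
    ∏ j : Fin n, fderiv ℝ (w j.succ) x (e (σ j.succ))
  have hP : ∀ σ, ContDiff ℝ ∞ (P σ) := fun σ =>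
    contDiff_prod fun j _ => (hw j.succ).contDiff_fderiv_apply _
  have hdet : ∀ x, (gradMatrix w x).det = ∑ σ : Equiv.Perm (Fin (n + 1)),
      ((Equiv.Perm.sign σ : ℤ) : ℂ) * (fderiv ℝ (w 0) x (e (σ 0)) * P σ x) := fun x => by
    rw [← Matrix.det_transpose, Matrix.det_apply']
    simp only [Fin.prod_univ_succ]
    rfl
  have hint : ∀ σ, Integrable fun x => fderiv ℝ (w 0) x (e (σ 0)) * P σ x := fun σ =>
    (((hw 0).contDiff_fderiv_apply _).continuous.mul
      (hP σ).continuous).integrable_of_hasCompactSupport ((hw 0).fderiv_apply _).2.mul_right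
  have hint' : ∀ σ, Integrable fun x => w 0 x * fderiv ℝ (P σ) x (e (σ 0)) := fun σ =>
    ((hw 0).1.continuous.mul (((hP σ).fderiv_right (m := ∞) (by simp)).clm_apply
      contDiff_const).continuous).integrable_of_hasCompactSupport (hw 0).2.mul_right
  have hparts : ∀ σ, ∫ x, fderiv ℝ (w 0) x (e (σ 0)) * P σ x =
      -∫ x, w 0 x * fderiv ℝ (P σ) x (e (σ 0)) := fun σ => by
    rw [integral_mul_fderiv_eq_neg_fderiv_mul_of_integrable (hint σ) (hint' σ), neg_neg]
    · exact ((hw 0).1.continuous.mul (hP σ).continuous).integrable_of_hasCompactSupport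
        (hw 0).2.mul_right
    · exact fun x _ => (hw 0).differentiable x
    · exact fun x _ => (hP σ).differentiable (by simp) x
  simp_rw [hdet]
  rw [integral_finsetSum _ fun σ _ => (hint σ).const_mul _]
  simp_rw [integral_const_mul, hparts, mul_neg, ← integral_const_mul]
  rw [Finset.sum_neg_distrib, ← integral_finsetSum _ fun σ _ => (hint' σ).const_mul _]
  refine neg_eq_zero.2 (integral_eq_zero_of_ae (Filter.Eventually.of_forall fun x => ?_))
  have hder : ∀ σ, fderiv ℝ (P σ) x (e (σ 0)) = ∑ j : Fin n,
      (∏ k ∈ Finset.univ.erase j, fderiv ℝ (w k.succ) x (e (σ k.succ))) *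
        fderiv ℝ (fun y => fderiv ℝ (w j.succ) y (e (σ j.succ))) x (e (σ 0)) := fun σ => by
    have := fderiv_finsetProd (𝕜 := ℝ) (u := Finset.univ) (x := x)
      (g := fun (j : Fin n) y => fderiv ℝ (w j.succ) y (e (σ j.succ)))
      fun j _ => ((hw j.succ).contDiff_fderiv_apply _).differentiable (by simp) x
    simp only [P, this, sum_apply, smul_apply, smul_eq_mul]
  simp_rw [hder, Finset.mul_sum]
  rw [Finset.sum_comm]
  refine Finset.sum_eq_zero fun j _ => ?_
  refine sum_sign_mul_eq_zero (Fin.succ_ne_zero j).symm _ fun σ => ?_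
  simp only [Equiv.Perm.mul_apply, Equiv.swap_apply_left, Equiv.swap_apply_right]
  rw [IsTest.fderiv_fderiv_comm (hw j.succ)]
  congr 2
  refine Finset.prod_congr rfl fun k hk => ?_
  rw [Equiv.swap_apply_of_ne_of_ne (Fin.succ_ne_zero k)
    fun h => (Finset.ne_of_mem_erase hk) (Fin.succ_injective _ h)]

lemma integrable_topForm {w : Fin (q + 1) → EuclideanSpace ℝ (Fin q) → ℂ}
    (hw : ∀ j, IsTest (w j)) : Integrable (topForm w) := by
  have h : Continuous (gradMatrix fun j => w j.succ) := continuous_matrix fun j i =>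
    ((hw j.succ).contDiff_fderiv_apply (EuclideanSpace.single i 1)).continuous
  exact ((hw 0).1.continuous.mul h.matrix_det).integrable_of_hasCompactSupport
    (HasCompactSupport.mul_right (hw 0).2)

/-- `∫ v₁ dv₂ ∧ ⋯ ∧ dv_q ∧ dv₀ = (-1)^q ∫ v₀ dv₁ ∧ ⋯ ∧ dv_q`: Stokes' theorem applied to
`d(v₀ v₁) ∧ dv₂ ∧ ⋯ ∧ dv_q`, followed by a cyclic permutation of the rows of the determinant. -/
lemma integral_topForm_rotate {w : Fin (q + 1) → EuclideanSpace ℝ (Fin q) → ℂ}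
    (hw : ∀ j, IsTest (w j)) :
    ∫ x, topForm (fun j => w (j + 1)) x = (-1) ^ q * ∫ x, topForm w x := by
  cases q with
  | zero =>
    rw [show (fun j : Fin (0 + 1) => w (j + 1)) = w from
      funext fun j => congrArg w (Fin.ext (by omega))]
    simp
  | succ n =>
    -- Moving the last row `dv₀` to the first place is a cycle of length `n + 1`, of sign `(-1)^n`.
    have hrot : ∀ x, topForm (fun j => w (j + 1)) x =
        (-1) ^ n * (w 1 x * (gradMatrix
          (Function.update (fun j : Fin (n + 1) => w j.succ) 0 (w 0)) x).det) := fun x => by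
      have : gradMatrix (fun j : Fin (n + 1) => w (j.succ + 1)) x =
          (gradMatrix (Function.update (fun j : Fin (n + 1) => w j.succ) 0 (w 0)) x).submatrix
            (finRotate (n + 1)) id := by
        ext j i
        simp only [gradMatrix, Matrix.of_apply, Matrix.submatrix_apply, id, finRotate_apply]
        congr 2
        induction j using Fin.lastCases with
        | last => simp
        | cast j =>
          rw [Function.update_of_ne (by simp), Fin.coeSucc_eq_succ, Fin.succ_castSucc,
            Fin.coeSucc_eq_succ]
      rw [topForm, this, Matrix.det_permute, sign_finRotate]
      simp
      ring
    have hprod : ∀ x, (gradMatrix (Function.update (fun j : Fin (n + 1) => w j.succ) 0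
          fun y => w 0 y * w 1 y) x).det = topForm w x + w 1 x * (gradMatrix
          (Function.update (fun j : Fin (n + 1) => w j.succ) 0 (w 0)) x).det := fun x => by
      have h := fderiv_fun_mul ((hw 0).differentiable x) ((hw 1).differentiable x)
      rw [gradMatrix_update, gradMatrix_update, h, topForm, ← Matrix.det_updateRow_smul]
      have : (gradMatrix (fun j : Fin (n + 1) => w j.succ) x) =
          (gradMatrix (fun j : Fin (n + 1) => w j.succ) x).updateRow 0
            fun i => fderiv ℝ (w 1) x (EuclideanSpace.single i 1) := by
        rw [← gradMatrix_update]
        congr 1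
        exact (Function.update_eq_self 0 (fun j : Fin (n + 1) => w j.succ)).symm
      conv_rhs => enter [1]; rw [this]
      rw [← Matrix.det_updateRow_smul, ← Matrix.det_updateRow_add]
      rfl
    have hzero := integral_det_gradMatrix (w := Function.update (fun j : Fin (n + 1) => w j.succ) 0
      fun y => w 0 y * w 1 y) fun j => by
        by_cases h : j = 0
        · subst h; simpa using (hw 0).mul (hw 1)
        · simpa [h] using hw j.succ
    have hsq : ((-1 : ℂ) ^ n) * (-1) ^ n = 1 := by rw [← mul_pow]; simp
    have hprod' : ∀ x, (gradMatrix (Function.update (fun j : Fin (n + 1) => w j.succ) 0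
          fun y => w 0 y * w 1 y) x).det =
        topForm w x + (-1) ^ n * topForm (fun j => w (j + 1)) x := fun x => by
      rw [hprod, hrot, ← mul_assoc, hsq, one_mul]
    -- `hzero` now reads `∫ v₀ dv₁ ∧ ⋯ ∧ dv_q + (-1)^(q-1) ∫ v₁ dv₂ ∧ ⋯ ∧ dv_q ∧ dv₀ = 0`.
    simp_rw [hprod'] at hzero
    rw [integral_add (integrable_topForm hw)
      ((integrable_topForm fun j => hw (j + 1)).const_mul _), integral_const_mul] at hzero
    linear_combination (-1) ^ n * hzero - (∫ x, topForm (fun j => w (j + 1)) x) * hsq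

/-! ### Integration along the slices -/

lemma continuous_topForm_slice {V : Fin (q + 1) → EuclideanSpace ℝ (Fin q) × ℝ → ℂ}
    (hV : ∀ j, IsTest (V j)) :
    Continuous fun z : EuclideanSpace ℝ (Fin q) × ℝ => topForm (fun j x => V j (x, z.2)) z.1 := by
  refine (hV 0).1.continuous.mul (Continuous.matrix_det (continuous_matrix fun j i => ?_))
  simp only [gradMatrix, Matrix.of_apply, (hV _).fderiv_slice]
  exact ((hV _).contDiff_fderiv_apply _).continuous

/-- The functional `∫ η(t) dt ∫ v₀ dv₁ ∧ ⋯ ∧ dv_q`, the differentials being taken along the slices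
`ℝ^q × {t}`. -/
def sliceIntegral (η : ℝ → ℂ) (V : Fin (q + 1) → EuclideanSpace ℝ (Fin q) × ℝ → ℂ) : ℂ :=
  ∫ t, η t * ∫ x, topForm (fun j x => V j (x, t)) x

lemma integrable_sliceIntegral {η : ℝ → ℂ} (hη : Continuous η)
    {V : Fin (q + 1) → EuclideanSpace ℝ (Fin q) × ℝ → ℂ} (hV : ∀ j, IsTest (V j)) :
    Integrable fun t => η t * ∫ x, topForm (fun j x => V j (x, t)) x := by
  have h : Integrable (fun z : EuclideanSpace ℝ (Fin q) × ℝ =>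
      η z.2 * topForm (fun j x => V j (x, z.2)) z.1) (volume.prod volume) := by
    refine Continuous.integrable_of_hasCompactSupport
      ((hη.comp continuous_snd).mul (continuous_topForm_slice hV)) ?_
    exact HasCompactSupport.mul_left (HasCompactSupport.mul_right (hV 0).2)
  simpa only [integral_const_mul] using h.integral_prod_right

section

variable {η : ℝ → ℂ} {V : Fin (q + 1) → EuclideanSpace ℝ (Fin q) × ℝ → ℂ}
  {u v : EuclideanSpace ℝ (Fin q) × ℝ → ℂ}

lemma IsTest.update (hV : ∀ j, IsTest (V j)) (k : Fin (q + 1)) (hu : IsTest u) (j : Fin (q + 1)) :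
    IsTest (Function.update V k u j) := by
  by_cases h : j = k
  · subst h; simpa using hu
  · simpa [h] using hV j

lemma slice_update (V : Fin (q + 1) → EuclideanSpace ℝ (Fin q) × ℝ → ℂ) (k : Fin (q + 1))
    (u : EuclideanSpace ℝ (Fin q) × ℝ → ℂ) (t : ℝ) :
    (fun j x => Function.update V k u j (x, t)) =
      Function.update (fun j x => V j (x, t)) k fun x => u (x, t) := by
  funext j
  by_cases h : j = k
  · subst h; simp
  · simp [h]

lemma sliceIntegral_update_add (hη : Continuous η) (hV : ∀ j, IsTest (V j)) (k : Fin (q + 1))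
    (hu : IsTest u) (hv : IsTest v) :
    sliceIntegral η (Function.update V k (u + v)) =
      sliceIntegral η (Function.update V k u) + sliceIntegral η (Function.update V k v) := by
  have hU := IsTest.update hV k hu
  have hW := IsTest.update hV k hv
  rw [sliceIntegral, sliceIntegral, sliceIntegral, ← integral_add (integrable_sliceIntegral hη hU)
    (integrable_sliceIntegral hη hW)]
  refine integral_congr_ae (Filter.Eventually.of_forall fun t => ?_)
  simp only
  rw [← mul_add, ← integral_add (integrable_topForm fun j => (hU j).slice t)
    (integrable_topForm fun j => (hW j).slice t)]
  simp only [slice_update]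
  congr 2
  funext x
  exact topForm_update_add _ _ ((hu.slice t).differentiable x) ((hv.slice t).differentiable x)

lemma sliceIntegral_update_smul (k : Fin (q + 1)) (c : ℂ) (hu : IsTest u) :
    sliceIntegral η (Function.update V k (c • u)) =
      c * sliceIntegral η (Function.update V k u) := by
  rw [sliceIntegral, sliceIntegral, ← integral_const_mul]
  refine integral_congr_ae (Filter.Eventually.of_forall fun t => ?_)
  simp only
  rw [mul_left_comm, ← integral_const_mul c]
  simp only [slice_update]
  congr 2
  funext x
  exact topForm_update_smul _ _ c ((hu.slice t).differentiable x)

lemma sliceIntegral_rotate (hV : ∀ j, IsTest (V j)) :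
    sliceIntegral η (fun j => V (j + 1)) = (-1) ^ q * sliceIntegral η V := by
  rw [sliceIntegral, sliceIntegral, ← integral_const_mul]
  refine integral_congr_ae (Filter.Eventually.of_forall fun t => ?_)
  simp only
  rw [mul_left_comm, ← integral_topForm_rotate fun j => (hV j).slice t]

end

/-! ### Invariance under affine changes of variables -/

lemma topForm_comp_affine (B : Aff q) {w : Fin (q + 1) → EuclideanSpace ℝ (Fin q) → ℂ}
    (hw : ∀ j, Differentiable ℝ (w j)) (x : EuclideanSpace ℝ (Fin q)) :
    topForm (fun j y => w j (B y)) x =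
      ((LinearMap.det (B.linear : EuclideanSpace ℝ (Fin q) →ₗ[ℝ] EuclideanSpace ℝ (Fin q)) : ℝ) : ℂ)
        * topForm w (B x) := by
  let b := (EuclideanSpace.basisFun (Fin q) ℝ).toBasis
  let L : EuclideanSpace ℝ (Fin q) →ₗ[ℝ] EuclideanSpace ℝ (Fin q) := B.linear
  have hB : HasFDerivAt (fun y => B y) (LinearMap.toContinuousLinearMap L) x :=
    B.toContinuousAffineEquiv.toContinuousAffineMap.hasFDerivAt
  have hmat : gradMatrix (fun (j : Fin q) y => w j.succ (B y)) x =
      gradMatrix (fun j => w j.succ) (B x) * (LinearMap.toMatrix b b L).map Complex.ofRealHom := by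
    ext j i
    have h : HasFDerivAt (fun y => w j.succ (B y)) _ x :=
      HasFDerivAt.comp x (hw j.succ (B x)).hasFDerivAt hB
    have hLi : L (EuclideanSpace.single i 1) =
        ∑ k, LinearMap.toMatrix b b L k i • EuclideanSpace.single k (1 : ℝ) := by
      have := (b.sum_repr (L (b i))).symm
      simpa [b, LinearMap.toMatrix_apply] using this
    simp only [gradMatrix, Matrix.of_apply, h.fderiv, Matrix.mul_apply]
    simp only [ContinuousLinearMap.comp_apply, LinearMap.coe_toContinuousLinearMap', hLi, map_sum,
      map_smul, Matrix.map_apply, Complex.ofRealHom_eq_coe, Complex.real_smul]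
    exact Finset.sum_congr rfl fun k _ => mul_comm _ _
  rw [topForm, hmat, Matrix.det_mul, ← RingHom.mapMatrix_apply, ← RingHom.map_det,
    LinearMap.det_toMatrix]
  simp only [topForm, Complex.ofRealHom_eq_coe]
  ring

lemma integral_comp_affine (B : Aff q) (f : EuclideanSpace ℝ (Fin q) → ℂ) :
    ∫ x, (B.delta : ℂ) * f (B x) = ∫ x, f x := by
  have h := integral_image_eq_integral_abs_det_fderiv_smul (s := Set.univ) (f := B)
    (f' := fun _ => LinearMap.toContinuousLinearMap
      (B.linear : EuclideanSpace ℝ (Fin q) →ₗ[ℝ] EuclideanSpace ℝ (Fin q))) volume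
    MeasurableSet.univ
    (fun x _ =>
      (B.toContinuousAffineEquiv.toContinuousAffineMap.hasFDerivAt (x := x)).hasFDerivWithinAt)
    B.injective.injOn f
  rw [Set.image_univ_of_surjective B.surjective] at h
  simp only [Measure.restrict_univ] at h
  rw [h]
  simp only [Complex.real_smul]
  rfl

/-- The functional `sliceIntegral η` is invariant under an orientation preserving affine map `B`
acting on `ℝ^q × ℝ`, as soon as the weight `η` is invariant under translation by `log δ(B)`. -/
lemma sliceIntegral_comp_shift {η : ℝ → ℂ} (B : Aff q)
    (hB : 0 < LinearMap.det (B.linear : EuclideanSpace ℝ (Fin q) →ₗ[ℝ] EuclideanSpace ℝ (Fin q)))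
    (hη : ∀ t, η (t + Real.log B.delta) = η t)
    {V : Fin (q + 1) → EuclideanSpace ℝ (Fin q) × ℝ → ℂ} (hV : ∀ j, IsTest (V j)) :
    sliceIntegral η (fun j z => V j (B.shift z)) = sliceIntegral η V := by
  have h : ∀ t, ∫ x, topForm (fun j x => V j (B.shift (x, t))) x =
      ∫ x, topForm (fun j x => V j (x, t + Real.log B.delta)) x := fun t => by
    rw [← integral_comp_affine B (topForm fun j x => V j (x, t + Real.log B.delta))]
    refine integral_congr_ae (Filter.Eventually.of_forall fun x => ?_)
    exact (topForm_comp_affine B (w := fun j x => V j (x, t + Real.log B.delta))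
      (fun j => ((hV j).slice _).differentiable) x).trans
        (congrArg (fun r : ℝ => (r : ℂ) * _) (abs_of_pos hB).symm)
  rw [sliceIntegral, sliceIntegral]
  simp only [h]
  rw [← integral_add_right_eq_self (fun t => η t * ∫ x, topForm (fun j x => V j (x, t)) x)
    (Real.log B.delta)]
  simp only [hη]

/-! ### The Hochschild identity for functions -/

lemma sum_alternating_telescope {n : ℕ} (G : Fin (n + 1) → ℂ) :
    ∑ j : Fin n, (-1) ^ (j : ℕ) * (G j.castSucc + G j.succ) =
      G 0 - (-1) ^ n * G (Fin.last n) := by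
  induction n with
  | zero => simp
  | succ n ih =>
    have := ih fun j => G j.castSucc
    simp only [Fin.castSucc_zero] at this
    rw [Fin.sum_univ_castSucc]
    simp only [Fin.val_castSucc, Fin.succ_castSucc, this, Fin.val_last, Fin.succ_last]
    ring

lemma contractNth_succ_succ {α : Type*} {m : ℕ} (op : α → α → α) (w : Fin (m + 2) → α)
    (k : Fin m) : (fun i : Fin m => k.succ.castSucc.contractNth op w i.succ) =
      Function.update (fun i => w (k.succ.succAbove i).succ) k
        (op (w k.castSucc.succ) (w k.succ.succ)) := by
  funext i
  rcases lt_trichotomy i k with h | h | h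
  · rw [Fin.contractNth_apply_of_lt _ _ _ _ (by simpa using h), Function.update_of_ne h.ne,
      Fin.succAbove_of_castSucc_lt _ _ (by simpa [Fin.lt_def] using (Nat.lt_succ_of_lt h)),
      Fin.succ_castSucc]
  · subst h
    rw [Fin.contractNth_apply_of_eq _ _ _ _ (by simp), Function.update_self, Fin.succ_castSucc]
  · rw [Fin.contractNth_apply_of_gt _ _ _ _ (by simpa using h), Function.update_of_ne h.ne',
      Fin.succAbove_of_le_castSucc _ _ (by simpa [Fin.le_def] using (Nat.succ_le_of_lt h))]

/-- The form `w₀ dw₁ ∧ ⋯ ∧ dw_q` is a Hochschild cocycle on commuting functions. By the Leibniz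
rule, contracting the `j`-th and `(j+1)`-st function gives `w₀ (G j + G (j+1))`, where `G k` is
`wₖ` times the form with the `k`-th differential omitted; the alternating sum telescopes. -/
lemma hochschild_topForm {w : Fin (q + 2) → EuclideanSpace ℝ (Fin q) → ℂ}
    {x : EuclideanSpace ℝ (Fin q)} (hw : ∀ j, DifferentiableAt ℝ (w j) x) :
    (∑ j : Fin (q + 1), (-1) ^ (j : ℕ) * topForm (j.castSucc.contractNth (· * ·) w) x)
      + (-1) ^ (q + 1) *
        topForm (Function.update (Fin.init w) 0 (w (Fin.last (q + 1)) * w 0)) x = 0 := by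
  -- The differential of `w 0` never occurs, so the `0`-th term of the telescope is set to zero.
  let G : Fin (q + 2) → ℂ := Fin.cons 0 fun k =>
    w k.succ x * (gradMatrix (fun i : Fin q => w (k.succAbove i).succ) x).det
  have hterm : ∀ j : Fin (q + 1), topForm (j.castSucc.contractNth (· * ·) w) x =
      w 0 x * (G j.castSucc + G j.succ) := by
    intro j
    cases j using Fin.cases with
    | zero =>
      simp only [topForm, Fin.castSucc_zero, Fin.contractNth, G, Fin.cons_zero, Fin.cons_succ]
      simp [mul_assoc]
    | succ k =>
      have h0 : k.succ.castSucc.contractNth (· * ·) w 0 = w 0 :=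
        Fin.contractNth_apply_of_lt _ _ _ _ (by simp)
      -- The two families of rows differ in the row `k` only, which is `dw_{k+1}` or `dw_{k+2}`.
      have hrow : gradMatrix (fun i : Fin q => w (k.succ.succAbove i).succ) x =
          (gradMatrix (fun i : Fin q => w (k.succ.succAbove i).succ) x).updateRow k
            fun i => fderiv ℝ (w k.castSucc.succ) x (EuclideanSpace.single i 1) := by
        rw [← gradMatrix_update]
        congr 1
        rw [eq_comm, Function.update_eq_self_iff]
        rw [Fin.succAbove_of_castSucc_lt _ _ (by simp [Fin.lt_def])]
      have hrow' : gradMatrix (fun i : Fin q => w (k.castSucc.succAbove i).succ) x =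
          (gradMatrix (fun i : Fin q => w (k.succ.succAbove i).succ) x).updateRow k
            fun i => fderiv ℝ (w k.succ.succ) x (EuclideanSpace.single i 1) := by
        rw [← gradMatrix_update]
        congr 1
        funext i
        by_cases h : i = k
        · subst h; simp
        · rw [Function.update_of_ne h]
          rcases lt_or_gt_of_ne h with h | h
          · rw [Fin.succAbove_of_castSucc_lt _ _ (by simpa using h),
              Fin.succAbove_of_castSucc_lt _ _
                (by simpa [Fin.lt_def] using (Nat.lt_succ_of_lt h))]
          · rw [Fin.succAbove_of_le_castSucc _ _ (by simpa using h.le),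
              Fin.succAbove_of_le_castSucc _ _
                (by simpa [Fin.le_def] using (Nat.succ_le_of_lt h))]
      have hG : G k.succ.castSucc =
          w k.castSucc.succ x *
            (gradMatrix (fun i : Fin q => w (k.castSucc.succAbove i).succ) x).det := rfl
      have hG' : G k.succ.succ =
          w k.succ.succ x * (gradMatrix (fun i : Fin q => w (k.succ.succAbove i).succ) x).det :=
        rfl
      rw [hG, hG', topForm, h0, contractNth_succ_succ, gradMatrix_update,
        fderiv_mul (hw _) (hw _), hrow', hrow, Matrix.updateRow_idem, Matrix.updateRow_idem]
      congr 1
      rw [← Matrix.det_updateRow_smul, ← Matrix.det_updateRow_smul, ← Matrix.det_updateRow_add]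
      rfl
  have hlast : topForm (Function.update (Fin.init w) 0 (w (Fin.last (q + 1)) * w 0)) x =
      w 0 x * G (Fin.last (q + 1)) := by
    have hG : G (Fin.last (q + 1)) = w (Fin.last (q + 1)) x *
        (gradMatrix (fun i : Fin q => w ((Fin.last q).succAbove i).succ) x).det := rfl
    rw [hG, topForm, update_succ_zero, Function.update_self]
    simp only [Fin.succAbove_last, Fin.init, Fin.succ_castSucc, Pi.mul_apply]
    ring
  simp only [hterm, hlast, mul_left_comm _ (w 0 x)]
  rw [← Finset.mul_sum, sum_alternating_telescope]
  have : G 0 = 0 := rfl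
  rw [this]
  ring

lemma IsTest.contractNth {E : Type*} [NormedAddCommGroup E] [NormedSpace ℝ E] {m : ℕ}
    {V : Fin (m + 1) → E → ℂ} (hV : ∀ j, IsTest (V j)) (j : Fin (m + 1)) (k : Fin m) :
    IsTest (j.contractNth (· * ·) V k) := by
  unfold Fin.contractNth
  split_ifs
  exacts [hV _, (hV _).mul (hV _), hV _]

lemma sum_sliceIntegral_eq_zero {η : ℝ → ℂ} (hη : Continuous η) {ι : Type*} [Fintype ι]
    (c : ι → ℂ) (W : ι → Fin (q + 1) → EuclideanSpace ℝ (Fin q) × ℝ → ℂ)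
    (hW : ∀ i j, IsTest (W i j))
    (h : ∀ t x, ∑ i, c i * topForm (fun j x => W i j (x, t)) x = 0) :
    ∑ i, c i * sliceIntegral η (W i) = 0 := by
  simp only [sliceIntegral, ← integral_const_mul (r := c _)]
  rw [← integral_finsetSum _ fun i _ => (integrable_sliceIntegral hη (hW i)).const_mul _]
  refine integral_eq_zero_of_ae (Filter.Eventually.of_forall fun t => ?_)
  have key : ∑ i, c i * ∫ x, topForm (fun j x => W i j (x, t)) x = 0 := by
    simp only [← integral_const_mul]
    rw [← integral_finsetSum _ fun i _ =>
      (integrable_topForm fun j => (hW i j).slice t).const_mul _]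
    exact integral_eq_zero_of_ae (Filter.Eventually.of_forall fun x => h t x)
  simp only [mul_left_comm _ (η t)]
  rw [← Finset.mul_sum, key, mul_zero]
  rfl

lemma hochschild_sliceIntegral {η : ℝ → ℂ} (hη : Continuous η)
    {V : Fin (q + 2) → EuclideanSpace ℝ (Fin q) × ℝ → ℂ} (hV : ∀ j, IsTest (V j)) :
    (∑ j : Fin (q + 1), (-1) ^ (j : ℕ) * sliceIntegral η (j.castSucc.contractNth (· * ·) V))
      + (-1) ^ (q + 1) *
        sliceIntegral η (Function.update (Fin.init V) 0 (V (Fin.last (q + 1)) * V 0)) = 0 := by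
  have h := sum_sliceIntegral_eq_zero hη (ι := Option (Fin (q + 1)))
    (fun i => i.elim ((-1) ^ (q + 1)) fun j => (-1) ^ (j : ℕ))
    (fun i => i.elim (Function.update (Fin.init V) 0 (V (Fin.last (q + 1)) * V 0))
      fun j => j.castSucc.contractNth (· * ·) V)
    (fun i => by
      cases i with
      | none => exact IsTest.update (fun j => hV j.castSucc) 0 ((hV _).mul (hV _))
      | some j => exact IsTest.contractNth hV j.castSucc)
    (fun t x => by
      rw [Fintype.sum_option, add_comm,
        ← hochschild_topForm fun j => ((hV j).slice t).differentiable x]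
      congr 1
      · refine Finset.sum_congr rfl fun j _ => ?_
        simp only [Option.elim]
        congr 2
        funext k
        unfold Fin.contractNth
        split_ifs <;> rfl)
  rwa [Fintype.sum_option, add_comm] at h

/-! ### The weighted functionals on the convolution algebra -/

lemma Aff.shift_one (z : EuclideanSpace ℝ (Fin q) × ℝ) : (1 : Aff q).shift z = z := by
  have h : (1 : Aff q).delta = 1 := by
    have : ((1 : Aff q).linear : EuclideanSpace ℝ (Fin q) →ₗ[ℝ] EuclideanSpace ℝ (Fin q)) =
        LinearMap.id := rfl
    rw [Aff.delta, this, LinearMap.det_id, abs_one]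
  simp [Aff.shift, h]

lemma Aff.shift_inv_shift (A : Aff q) (z : EuclideanSpace ℝ (Fin q) × ℝ) :
    A⁻¹.shift (A.shift z) = z := by
  rw [← Aff.shift_mul, inv_mul_cancel, Aff.shift_one]

lemma Aff.shift_shift_inv (A : Aff q) (z : EuclideanSpace ℝ (Fin q) × ℝ) :
    A.shift (A⁻¹.shift z) = z := by
  rw [← Aff.shift_mul, mul_inv_cancel, Aff.shift_one]

lemma IsTest.comp_shift {u : EuclideanSpace ℝ (Fin q) × ℝ → ℂ} (hu : IsTest u) (A : Aff q) :
    IsTest fun z => u (A.shift z) :=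
  ⟨hu.1.comp A.shift_contDiff, hu.2.comp_homeomorph
    { toFun := A.shift
      invFun := A⁻¹.shift
      left_inv := A.shift_inv_shift
      right_inv := A.shift_shift_inv
      continuous_toFun := A.shift_contDiff.continuous
      continuous_invFun := A⁻¹.shift_contDiff.continuous }⟩

lemma sliceIntegral_eq_zero {η : ℝ → ℂ} {V : Fin (q + 1) → EuclideanSpace ℝ (Fin q) × ℝ → ℂ}
    {k : Fin (q + 1)} (hk : V k = 0) : sliceIntegral η V = 0 := by
  have h := sliceIntegral_update_smul (η := η) (V := V) k 0 (u := 0)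
    ⟨contDiff_const, HasCompactSupport.zero⟩
  rw [smul_zero, zero_mul] at h
  rwa [← hk, Function.update_eq_self] at h

lemma partialProd_last {α : Type*} [Monoid α] {n : ℕ} (a : Fin n → α) :
    Fin.partialProd a (Fin.last n) = (List.ofFn a).prod := by
  simp [Fin.partialProd, List.take_of_length_le]

/-- Rotating a tuple with product `1` multiplies its partial products by the inverse of the first
entry. -/
lemma mul_partialProd_rotate {α : Type*} [Group α] {n : ℕ} {a : Fin (n + 1) → α}
    (ha : (List.ofFn a).prod = 1) (j : Fin (n + 1)) :
    a 0 * Fin.partialProd (fun i => a (i + 1)) j.succ = Fin.partialProd a (j + 1).succ := by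
  have hinit : Fin.init (fun i => a (i + 1)) = Fin.tail a := by
    funext i
    simp [Fin.init, Fin.tail]
  have htail : a 0 * Fin.partialProd (Fin.tail a) (Fin.last n) = 1 := by
    rw [← Fin.partialProd_succ', Fin.succ_last, partialProd_last, ha]
  induction j using Fin.lastCases with
  | last =>
    rw [Fin.partialProd_succ, ← Fin.partialProd_init, hinit, ← mul_assoc, htail]
    simpa using (Fin.partialProd_succ' a 0).symm
  | cast i =>
    rw [Fin.succ_castSucc, ← Fin.partialProd_init, hinit, Fin.coeSucc_eq_succ,
      Fin.partialProd_succ']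

lemma prod_rotate_eq_one_iff {α : Type*} [Group α] {n : ℕ} {a : Fin (n + 1) → α} :
    (List.ofFn fun i => a (i + 1)).prod = 1 ↔ (List.ofFn a).prod = 1 := by
  have h : (List.ofFn fun i => a (i + 1)).prod = (List.ofFn (Fin.tail a)).prod * a 0 := by
    rw [← partialProd_last, ← Fin.succ_last, Fin.partialProd_succ, ← Fin.partialProd_init,
      ← partialProd_last]
    congr 2
    · funext i
      simp [Fin.init, Fin.tail]
    · simp
  rw [h, List.ofFn_succ, List.prod_cons]
  exact mul_eq_one_comm

namespace AffineGroupoid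

variable (G : AffineGroupoid q) {n : ℕ}

/-- The affine map `A` carries some arrow of `G`. -/
def IsCarried (A : Aff q) : Prop := ∃ x, (A, x) ∈ G.arrows

variable {G}

lemma IsCarried.inv {A : Aff q} (hA : G.IsCarried A) : G.IsCarried A⁻¹ :=
  hA.elim fun x hx => ⟨A x, G.inv_mem hx⟩

lemma Algebra.mem_arrows (f : G.Algebra) {A : Aff q} {z : EuclideanSpace ℝ (Fin q) × ℝ}
    (h : f.val A z ≠ 0) : (A, z.1) ∈ G.arrows :=
  (f.val_mem.1 A).2.2 (subset_tsupport _ h)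

lemma Algebra.isCarried (f : G.Algebra) {A : Aff q} (h : f.val A ≠ 0) : G.IsCarried A := by
  obtain ⟨z, hz⟩ := Function.ne_iff.1 h
  exact ⟨z.1, f.mem_arrows hz⟩

lemma Algebra.isTest (f : G.Algebra) (A : Aff q) : IsTest (f.val A) :=
  ⟨(f.val_mem.1 A).1, (f.val_mem.1 A).2.1⟩

/-- For a path `γ₀ γ₁ ⋯` of composable arrows of `G ⋊ ℝ` carried by `a 0, a 1, …`, the value
`fʲ(γ_j)` as a function of the range `z` of `γ₀`; the source of `γ_j` is `(a₀ ⋯ a_j)⁻¹ . z`. For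
paths whose product is a unit this agrees with `pullback`, which is parametrized by the source of
the last arrow. -/
def pathFunction (f : Fin n → G.Algebra) (a : Fin n → Aff q) (j : Fin n)
    (z : EuclideanSpace ℝ (Fin q) × ℝ) : ℂ :=
  (f j).val (a j) ((Fin.partialProd a j.succ)⁻¹.shift z)

lemma isTest_pathFunction (f : Fin n → G.Algebra) (a : Fin n → Aff q) (j : Fin n) :
    IsTest (pathFunction f a j) :=
  ((f j).isTest (a j)).comp_shift _

lemma pathFunction_eq_zero {f : Fin n → G.Algebra} {a : Fin n → Aff q} {j : Fin n}
    (h : (f j).val (a j) = 0) : pathFunction f a j = 0 := by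
  funext z
  simp [pathFunction, h]

lemma pullback_eq_pathFunction (f : Fin (q + 1) → G.Algebra) {a : Fin (q + 1) → Aff q}
    (ha : (List.ofFn a).prod = 1) (t : ℝ) (j : Fin (q + 1)) (x : EuclideanSpace ℝ (Fin q)) :
    pullback f a t j x = pathFunction f a j (x, t) := by
  have h : tail a j = (Fin.partialProd a j.succ)⁻¹ := by
    rw [eq_inv_iff_mul_eq_one, mul_eq_one_comm, ← ha, ← List.prod_take_mul_prod_drop _ (j + 1)]
    rfl
  rw [pullback, h, pathFunction]

lemma formCoeff_eq_topForm (f : Fin (q + 1) → G.Algebra) {a : Fin (q + 1) → Aff q}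
    (ha : (List.ofFn a).prod = 1) (t : ℝ) (x : EuclideanSpace ℝ (Fin q)) :
    formCoeff f a t x = topForm (fun j x => pathFunction f a j (x, t)) x := by
  rw [show (fun j x => pathFunction f a j (x, t)) = pullback f a t from
    funext fun j => funext fun x => (pullback_eq_pathFunction f ha t j x).symm]
  rfl

/-- The functional `ψ` with the measure `dt` replaced by `η(t) dt`. -/
def weightedPsi (G : AffineGroupoid q) (η : ℝ → ℂ) (f : Fin (q + 1) → G.Algebra) : ℂ :=
  ∑ᶠ a : {a : Fin (q + 1) → Aff q // (List.ofFn a).prod = 1}, sliceIntegral η (pathFunction f a.1)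

/-- Only finitely many tuples of sheets contribute to `weightedPsi`. -/
lemma finite_carriers (f : Fin (q + 1) → G.Algebra) :
    {a : {a : Fin (q + 1) → Aff q // (List.ofFn a).prod = 1} |
      ∀ j, (f j).val (a.1 j) ≠ 0}.Finite := by
  refine Set.Finite.preimage (f := Subtype.val) Subtype.val_injective.injOn
    (s := {a : Fin (q + 1) → Aff q | ∀ j, (f j).val (a j) ≠ 0}) ?_
  refine (Set.Finite.pi fun j => (f j).val_mem.2).subset fun a ha j _ => ha j

lemma finite_support_sliceIntegral (η : ℝ → ℂ) (f : Fin (q + 1) → G.Algebra) :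
    (Function.support fun a : {a : Fin (q + 1) → Aff q // (List.ofFn a).prod = 1} =>
      sliceIntegral η (pathFunction f a.1)).Finite :=
  (finite_carriers f).subset fun _ ha _ h0 => ha (sliceIntegral_eq_zero (pathFunction_eq_zero h0))

/-- The form is supported in the base, so that the integral over the base is an integral over
`ℝ^q`. -/
lemma formCoeff_eq_zero_of_notMem (f : Fin (q + 1) → G.Algebra) {a : Fin (q + 1) → Aff q}
    (ha : (List.ofFn a).prod = 1) (t : ℝ) {x : EuclideanSpace ℝ (Fin q)} (hx : x ∉ G.base) :
    formCoeff f a t x = 0 := by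
  have h0 : pullback f a t 0 x = 0 := by
    rw [pullback_eq_pathFunction f ha]
    by_contra h
    have h1 := G.range_mem ((f 0).mem_arrows h)
    have h2 : (a 0).shift ((Fin.partialProd a (0 : Fin (q + 1)).succ)⁻¹.shift (x, t)) = (x, t) := by
      rw [Fin.partialProd_succ']
      simp [Aff.shift_shift_inv]
    exact hx (cast (congrArg (· ∈ G.base) (congrArg Prod.fst h2)) h1)
  rw [formCoeff, h0, zero_mul]

lemma weightedPsi_eq_integral {η : ℝ → ℂ} (hη : Continuous η) (f : Fin (q + 1) → G.Algebra) :
    G.weightedPsi η f = ∫ t : ℝ, η t * ∫ x in G.base,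
      ∑ᶠ a : {a : Fin (q + 1) → Aff q // (List.ofFn a).prod = 1}, formCoeff f a.1 t x := by
  have hS := finite_carriers f
  have hS0 : ∀ a : {a : Fin (q + 1) → Aff q // (List.ofFn a).prod = 1}, a ∉ hS.toFinset →
      ∃ j, pathFunction f a.1 j = 0 := fun a ha => by
    have : ∃ j, (f j).val (a.1 j) = 0 := by simpa using ha
    exact this.imp fun j hj => pathFunction_eq_zero hj
  have h1 : ∀ t x, ∑ᶠ a : {a : Fin (q + 1) → Aff q // (List.ofFn a).prod = 1},
      formCoeff f a.1 t x = ∑ a ∈ hS.toFinset,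
        topForm (fun j x => pathFunction f a.1 j (x, t)) x := fun t x => by
    simp only [fun a : {a : Fin (q + 1) → Aff q // (List.ofFn a).prod = 1} =>
      formCoeff_eq_topForm f a.2 t x]
    refine finsum_eq_sum_of_support_subset _ fun a ha => ?_
    by_contra h
    obtain ⟨j, hj⟩ := hS0 a h
    exact ha (topForm_eq_zero (k := j) (funext fun x => congrFun hj (x, t)) x)
  have h2 : ∀ t, ∫ x in G.base, ∑ᶠ a : {a : Fin (q + 1) → Aff q // (List.ofFn a).prod = 1},
      formCoeff f a.1 t x = ∑ a ∈ hS.toFinset,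
        ∫ x, topForm (fun j x => pathFunction f a.1 j (x, t)) x := fun t => by
    rw [setIntegral_eq_integral_of_forall_compl_eq_zero fun x hx =>
      finsum_eq_zero_of_forall_eq_zero fun a => formCoeff_eq_zero_of_notMem f a.2 t hx]
    simp only [h1]
    exact integral_finsetSum _ fun a _ =>
      integrable_topForm fun j => (isTest_pathFunction f a.1 j).slice t
  simp only [h2, Finset.mul_sum]
  rw [integral_finsetSum _ fun a _ => integrable_sliceIntegral hη (isTest_pathFunction f a.1)]
  refine finsum_eq_sum_of_support_subset _ fun a ha => ?_
  by_contra h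
  obtain ⟨j, hj⟩ := hS0 a h
  exact ha (sliceIntegral_eq_zero hj)

lemma pathFunction_update (f : Fin n → G.Algebra) (a : Fin n → Aff q) (k : Fin n) (g : G.Algebra) :
    pathFunction (Function.update f k g) a =
      Function.update (pathFunction f a) k
        fun z => g.val (a k) ((Fin.partialProd a k.succ)⁻¹.shift z) := by
  funext j
  by_cases h : j = k
  · subst h; funext z; simp [pathFunction]
  · funext z; simp [pathFunction, h]

/-- `weightedPsi` as a multilinear map. -/
def weightedPsiMultilinear (G : AffineGroupoid q) {η : ℝ → ℂ} (hη : Continuous η) :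
    MultilinearMap ℂ (fun _ : Fin (q + 1) => G.Algebra) ℂ where
  toFun := G.weightedPsi η
  map_update_add' {inst} f k g h := by
    rw [Subsingleton.elim inst (instDecidableEqFin _)]
    rw [weightedPsi, weightedPsi, weightedPsi,
      ← finsum_add_distrib (finite_support_sliceIntegral η _) (finite_support_sliceIntegral η _)]
    refine finsum_congr fun a => ?_
    simp only [pathFunction_update]
    exact sliceIntegral_update_add hη (isTest_pathFunction f a.1) k
      ((g.isTest _).comp_shift _) ((h.isTest _).comp_shift _)
  map_update_smul' {inst} f k c g := by
    rw [Subsingleton.elim inst (instDecidableEqFin _)]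
    rw [weightedPsi, weightedPsi, smul_finsum]
    refine finsum_congr fun a => ?_
    simp only [pathFunction_update]
    exact sliceIntegral_update_smul k c ((g.isTest _).comp_shift _)

/-! ### Cyclic symmetry of the weighted functionals -/

/-- A continuous weight `η` on `ℝ` is invariant if it does not change under translation by
`log δ(γ)`, for the arrows `γ` of `G`. -/
structure IsInvariantWeight (G : AffineGroupoid q) (η : ℝ → ℂ) : Prop where
  continuous : Continuous η
  add_log_delta : ∀ A, G.IsCarried A → ∀ t, η (t + Real.log A.delta) = η t

/-- All arrows of `G` preserve the orientation. -/
def IsOriented (G : AffineGroupoid q) : Prop := ∀ A, G.IsCarried A →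
  0 < LinearMap.det (A.linear : EuclideanSpace ℝ (Fin q) →ₗ[ℝ] EuclideanSpace ℝ (Fin q))

lemma pathFunction_rotate (f : Fin (n + 1) → G.Algebra) {a : Fin (n + 1) → Aff q}
    (ha : (List.ofFn a).prod = 1) :
    pathFunction (fun j => f (j + 1)) (fun j => a (j + 1)) =
      fun j z => pathFunction f a (j + 1) ((a 0).shift z) := by
  funext j z
  simp only [pathFunction, ← Aff.shift_mul, ← mul_partialProd_rotate ha j]
  congr 2
  group

/-- Rotating the arguments moves the base point of a path by its first arrow; this does not
change the integrals, by `sliceIntegral_comp_shift`. -/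
lemma weightedPsi_rotate {η : ℝ → ℂ} (hG : G.IsOriented) (hη : G.IsInvariantWeight η)
    (f : Fin (q + 1) → G.Algebra) :
    G.weightedPsi η (fun j => f (j + 1)) = (-1) ^ q * G.weightedPsi η f := by
  let e : {a : Fin (q + 1) → Aff q // (List.ofFn a).prod = 1} ≃
      {a : Fin (q + 1) → Aff q // (List.ofFn a).prod = 1} :=
    ((Equiv.addRight (1 : Fin (q + 1))).symm.arrowCongr (Equiv.refl _)).subtypeEquiv
      fun a => prod_rotate_eq_one_iff.symm
  rw [weightedPsi, ← finsum_comp_equiv e, weightedPsi, ← smul_eq_mul, smul_finsum]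
  refine finsum_congr fun a => ?_
  change sliceIntegral η (pathFunction (fun j => f (j + 1)) fun j => a.1 (j + 1)) = _
  rw [pathFunction_rotate f a.2, smul_eq_mul, ← sliceIntegral_rotate (isTest_pathFunction f a.1)]
  -- The map `a 0` is only known to preserve `η` and the orientation if it carries an arrow of `G`.
  by_cases h0 : (f 0).val (a.1 0) = 0
  · have h1 := pathFunction_eq_zero h0
    rw [sliceIntegral_eq_zero (k := Fin.last q), sliceIntegral_eq_zero (k := Fin.last q)]
    · simpa using h1
    · funext z
      simp [h1]
  · exact sliceIntegral_comp_shift _ (hG _ ((f 0).isCarried h0))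
      (hη.2 _ ((f 0).isCarried h0)) fun j => isTest_pathFunction f a.1 (j + 1)

end AffineGroupoid

/-! ### Multilinearity of the Hochschild coboundary -/

section

variable {A : Type*} [NonUnitalRing A] [Module ℂ A] {k l : ℕ}

lemma exists_multilinear_comp (m : MultilinearMap ℂ (fun _ : Fin k => A) ℂ)
    {Φ : (Fin l → A) → Fin k → A}
    (hΦ : ∀ f i, ∃ (r : Fin k) (L : A →ₗ[ℂ] A), ∀ x,
      Φ (Function.update f i x) = Function.update (Φ f) r (L x)) :
    ∃ m' : MultilinearMap ℂ (fun _ : Fin l => A) ℂ, ∀ f, m' f = m (Φ f) := by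
  refine ⟨⟨fun f => m (Φ f), ?_, ?_⟩, fun f => rfl⟩
  · intro inst f i x y
    rw [Subsingleton.elim inst (instDecidableEqFin _)]
    obtain ⟨r, L, h⟩ := hΦ f i
    simp only [h, map_add, m.map_update_add]
  · intro inst f i c x
    rw [Subsingleton.elim inst (instDecidableEqFin _)]
    obtain ⟨r, L, h⟩ := hΦ f i
    simp only [h, map_smul, m.map_update_smul]

variable [IsScalarTower ℂ A A] [SMulCommClass ℂ A A]

/-- Changing one entry of a tuple changes one entry of the contracted tuple, and does so through a
linear map. -/
lemma contractNth_update (j : Fin (k + 1)) (f : Fin (k + 2) → A) (i : Fin (k + 2)) :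
    ∃ (r : Fin (k + 1)) (L : A →ₗ[ℂ] A), ∀ x,
      j.castSucc.contractNth (· * ·) (Function.update f i x) =
        Function.update (j.castSucc.contractNth (· * ·) f) r (L x) := by
  rcases lt_trichotomy i j.castSucc with h | h | h
  · refine ⟨⟨i, by have := i.2; have := j.2; simp only [Fin.lt_def, Fin.val_castSucc] at h; omega⟩,
      LinearMap.id, fun x => funext fun r => ?_⟩
    simp only [Fin.lt_def, Fin.val_castSucc] at h
    simp only [Fin.contractNth, Function.update_apply, Fin.ext_iff, Fin.val_castSucc, Fin.val_succ,
      LinearMap.id_apply]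
    split_ifs <;> first | rfl | omega
  · subst h
    refine ⟨j, LinearMap.mulRight ℂ (f j.succ), fun x => funext fun r => ?_⟩
    simp only [Fin.contractNth, Function.update_apply, Fin.ext_iff, Fin.val_castSucc, Fin.val_succ,
      LinearMap.mulRight_apply]
    split_ifs <;>
      first | rfl | omega | (congr 2; exact Fin.ext (by simp only [Fin.val_succ]; omega))
  · by_cases h' : i = j.succ
    · subst h'
      refine ⟨j, LinearMap.mulLeft ℂ (f j.castSucc), fun x => funext fun r => ?_⟩
      simp only [Fin.contractNth, Function.update_apply, Fin.ext_iff, Fin.val_castSucc,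
        Fin.val_succ, LinearMap.mulLeft_apply]
      split_ifs <;>
        first | rfl | omega | (congr 2; exact Fin.ext (by simp only [Fin.val_castSucc]; omega))
    · simp only [Fin.lt_def, Fin.val_castSucc, Fin.ext_iff, Fin.val_succ] at h h'
      refine ⟨⟨i - 1, by omega⟩, LinearMap.id, fun x => funext fun r => ?_⟩
      simp only [Fin.contractNth, Function.update_apply, Fin.ext_iff, Fin.val_castSucc,
        Fin.val_succ, LinearMap.id_apply]
      split_ifs <;> first | rfl | omega

/-- The analogue of `contractNth_update` for the cyclic face
`(f⁰, …, f^{k+1}) ↦ (f^{k+1} f⁰, f¹, …, f^k)`. -/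
lemma update_init_update (f : Fin (k + 2) → A) (i : Fin (k + 2)) :
    ∃ (r : Fin (k + 1)) (L : A →ₗ[ℂ] A), ∀ x,
      Function.update (Fin.init (Function.update f i x)) 0
          (Function.update f i x (Fin.last (k + 1)) * Function.update f i x 0) =
        Function.update (Function.update (Fin.init f) 0 (f (Fin.last (k + 1)) * f 0)) r (L x) := by
  induction i using Fin.lastCases with
  | last =>
    refine ⟨0, LinearMap.mulRight ℂ (f 0), fun x => ?_⟩
    rw [Fin.init_update_last, Function.update_idem, Function.update_self,
      Function.update_of_ne (Fin.last_pos).ne, LinearMap.mulRight_apply]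
  | cast i =>
    simp only [Fin.init_update_castSucc, Function.update_of_ne (Fin.castSucc_lt_last i).ne']
    by_cases h : i = 0
    · subst h
      refine ⟨0, LinearMap.mulLeft ℂ (f (Fin.last (k + 1))), fun x => ?_⟩
      simp
    · refine ⟨i, LinearMap.id, fun x => ?_⟩
      rw [Function.update_comm h, Function.update_of_ne (by simpa [eq_comm] using h),
        LinearMap.id_apply]

/-- The Hochschild coboundary of a multilinear functional is multilinear. -/
lemma exists_multilinear_hochschild (m : MultilinearMap ℂ (fun _ : Fin (k + 1) => A) ℂ) :
    ∃ m' : MultilinearMap ℂ (fun _ : Fin (k + 2) => A) ℂ, ∀ f, m' f =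
      (∑ j : Fin (k + 1), (-1) ^ (j : ℕ) * m (j.castSucc.contractNth (· * ·) f))
        + (-1) ^ (k + 1) *
          m (Function.update (Fin.init f) 0 (f (Fin.last (k + 1)) * f 0)) := by
  choose M hM using fun j : Fin (k + 1) =>
    exists_multilinear_comp m (fun f i => contractNth_update j f i)
  obtain ⟨M', hM'⟩ := exists_multilinear_comp m
    (Φ := fun f => Function.update (Fin.init f) 0 (f (Fin.last (k + 1)) * f 0)) update_init_update
  refine ⟨∑ j : Fin (k + 1), (-1 : ℂ) ^ (j : ℕ) • M j + (-1 : ℂ) ^ (k + 1) • M', fun f => ?_⟩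
  simp [sum_apply, hM, hM']

end

/-! ### The Hochschild identity of the weighted functionals -/

variable {n : ℕ}

lemma partialProd_update_init {α : Type*} [Monoid α] (a : Fin (n + 2) → α) (j : Fin (n + 1)) :
    Fin.partialProd (Function.update (Fin.init a) 0 (a (Fin.last (n + 1)) * a 0)) j.succ =
      a (Fin.last (n + 1)) * Fin.partialProd a j.castSucc.succ := by
  rw [Fin.succ_castSucc, ← Fin.partialProd_init, Fin.partialProd_succ', Fin.partialProd_succ',
    Function.update_self, mul_assoc]
  congr 3

namespace AffineGroupoid

variable {G : AffineGroupoid q}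

/-- `f` vanishes outside the sheet of the affine map `A`. -/
def Algebra.IsSingle (f : G.Algebra) (A : Aff q) : Prop := ∀ C, C ≠ A → f.val C = 0

lemma Algebra.val_mul_apply (f : G.Algebra) {g : G.Algebra} {B : Aff q} (hg : g.IsSingle B)
    (A : Aff q) (z : EuclideanSpace ℝ (Fin q) × ℝ) :
    (f * g).val A z = f.val (A * B⁻¹) (B.shift z) * g.val B z := by
  rw [Algebra.val_mul, conv]
  exact finsum_eq_single _ _ fun C hC => by simp [hg C hC]

lemma Algebra.IsSingle.mul {f g : G.Algebra} {A B : Aff q} (hf : f.IsSingle A)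
    (hg : g.IsSingle B) : (f * g).IsSingle (A * B) := by
  intro C hC
  funext z
  rw [f.val_mul_apply hg, hf _ fun h => hC (by rw [← h, inv_mul_cancel_right])]
  simp

/-- The element of the algebra that is given by `φ` on the sheet of `A` and vanishes on all other
sheets. -/
def sheetFunction (A : Aff q) (φ : testFunctions (G.sheet A)) : G.Algebra :=
  (⟨Set.indicator {A} fun _ => φ.1, fun B => by
      by_cases h : B = A
      · subst h
        rw [Set.indicator_of_mem (Set.mem_singleton B)]
        exact φ.2
      · rw [Set.indicator_of_notMem (by simpa using h)]
        exact zero_mem _,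
    (Set.finite_singleton A).subset Set.support_indicator_subset⟩ : G.smoothFunctions)

lemma val_sheetFunction (A : Aff q) (φ : testFunctions (G.sheet A)) :
    (sheetFunction A φ).val A = φ.1 :=
  Set.indicator_of_mem (Set.mem_singleton A) fun _ => φ.1

lemma isSingle_sheetFunction (A : Aff q) (φ : testFunctions (G.sheet A)) :
    (sheetFunction A φ).IsSingle A :=
  fun _ hC => Set.indicator_of_notMem (Set.mem_singleton_iff.not.2 hC) fun _ => φ.1

/-- The restriction of an element of the algebra to a single sheet. -/
def Algebra.restrict (f : G.Algebra) (A : Aff q) : G.Algebra :=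
  sheetFunction A ⟨f.val A, f.val_mem.1 A⟩

lemma Algebra.exists_eq_sum_restrict (f : G.Algebra) :
    ∃ s : Finset (Aff q), f = ∑ A ∈ s, f.restrict A := by
  classical
  obtain ⟨s, hs⟩ := G.exists_finset f.val_mem
  refine ⟨s, Algebra.val_injective ?_⟩
  have h : ∀ r : Finset (Aff q),
      (∑ A ∈ r, f.restrict A).val = ∑ A ∈ r, (f.restrict A).val := by
    intro r
    induction r using Finset.induction_on with
    | empty => simp [Algebra.val_zero]
    | insert A r hA ih =>
      rw [Finset.sum_insert hA, Finset.sum_insert hA, Algebra.val_add, ih]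
  rw [h]
  funext C
  rw [Finset.sum_apply]
  by_cases hC : C ∈ s
  · rw [Finset.sum_eq_single (f := fun A => (f.restrict A).val C) C
      (fun B _ hB => isSingle_sheetFunction _ _ C hB.symm) (fun h => absurd hC h)]
    exact (val_sheetFunction C ⟨f.val C, f.val_mem.1 C⟩).symm
  · rw [hs C hC, Finset.sum_eq_zero fun B hB => ?_]
    exact isSingle_sheetFunction _ _ C fun h => hC (h ▸ hB)

/-- A multilinear functional on the convolution algebra is determined by its values on elements
that are carried by single sheets. -/
lemma multilinear_eq_zero (m : MultilinearMap ℂ (fun _ : Fin n => G.Algebra) ℂ)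
    (hm : ∀ (f : Fin n → G.Algebra) (a : Fin n → Aff q), (∀ j, (f j).IsSingle (a j)) → m f = 0)
    (f : Fin n → G.Algebra) : m f = 0 := by
  choose s hs using fun j => (f j).exists_eq_sum_restrict
  have hf : f = fun j => ∑ A ∈ s j, (f j).restrict A := funext hs
  rw [hf, MultilinearMap.map_sum_finset]
  exact Finset.sum_eq_zero fun r _ => hm _ r fun j => isSingle_sheetFunction _ _

lemma weightedPsi_of_isSingle (η : ℝ → ℂ) {f : Fin (q + 1) → G.Algebra}
    {a : Fin (q + 1) → Aff q} (hf : ∀ j, (f j).IsSingle (a j))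
    [Decidable ((List.ofFn a).prod = 1)] :
    G.weightedPsi η f =
      if (List.ofFn a).prod = 1 then sliceIntegral η (pathFunction f a) else 0 := by
  have hzero : ∀ b : Fin (q + 1) → Aff q, b ≠ a → sliceIntegral η (pathFunction f b) = 0 := by
    intro b hb
    obtain ⟨j, hj⟩ := Function.ne_iff.1 hb
    exact sliceIntegral_eq_zero (pathFunction_eq_zero (hf j _ hj))
  rw [weightedPsi]
  split_ifs with h
  · exact finsum_eq_single
      (fun b : {b : Fin (q + 1) → Aff q // (List.ofFn b).prod = 1} =>
        sliceIntegral η (pathFunction f b.1)) ⟨a, h⟩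
      fun b hb => hzero b.1 fun h' => hb (Subtype.ext h')
  · exact finsum_eq_zero_of_forall_eq_zero fun b => hzero b.1 fun h' => h (h' ▸ b.2)

lemma isSingle_contractNth {f : Fin (n + 2) → G.Algebra} {a : Fin (n + 2) → Aff q}
    (hf : ∀ j, (f j).IsSingle (a j)) (j k : Fin (n + 1)) :
    (j.castSucc.contractNth (· * ·) f k).IsSingle (j.castSucc.contractNth (· * ·) a k) := by
  unfold Fin.contractNth
  split_ifs
  exacts [hf _, (hf _).mul (hf _), hf _]

/-- Multiplying two neighbours in a path of elements carried by single sheets amounts to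
multiplying the functions that are read off along the path. -/
lemma pathFunction_contractNth {f : Fin (n + 2) → G.Algebra} {a : Fin (n + 2) → Aff q}
    (hf : ∀ j, (f j).IsSingle (a j)) (j : Fin (n + 1)) :
    pathFunction (j.castSucc.contractNth (· * ·) f) (j.castSucc.contractNth (· * ·) a) =
      j.castSucc.contractNth (· * ·) (pathFunction f a) := by
  funext k z
  rw [pathFunction, Fin.partialProd_contractNth, Function.comp_apply]
  rcases lt_trichotomy (k : ℕ) (j : ℕ) with h | h | h
  · rw [Fin.contractNth_apply_of_lt _ _ _ _ h, Fin.contractNth_apply_of_lt _ _ _ _ h,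
      Fin.contractNth_apply_of_lt _ _ _ _ h, Fin.succAbove_of_castSucc_lt _ _
        (Nat.succ_lt_succ h : (k : ℕ) + 1 < (j : ℕ) + 1)]
    rfl
  · rw [Fin.contractNth_apply_of_eq _ _ _ _ h, Fin.contractNth_apply_of_eq _ _ _ _ h,
      Fin.contractNth_apply_of_eq _ _ _ _ h, Fin.succAbove_of_le_castSucc _ _
        (Nat.succ_le_succ h.ge : (j : ℕ) + 1 ≤ (k : ℕ) + 1), Algebra.val_mul_apply _ (hf _),
      mul_inv_cancel_right, ← Aff.shift_mul, Pi.mul_apply, pathFunction, pathFunction,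
      Fin.partialProd_succ a k.succ, Fin.succ_castSucc]
    congr 3
    group
  · rw [Fin.contractNth_apply_of_gt _ _ _ _ h, Fin.contractNth_apply_of_gt _ _ _ _ h,
      Fin.contractNth_apply_of_gt _ _ _ _ h, Fin.succAbove_of_le_castSucc _ _
        (Nat.succ_le_succ h.le : (j : ℕ) + 1 ≤ (k : ℕ) + 1)]
    rfl

lemma prod_contractNth (a : Fin (n + 2) → Aff q) (j : Fin (n + 1)) :
    (List.ofFn (j.castSucc.contractNth (· * ·) a)).prod = (List.ofFn a).prod := by
  rw [← partialProd_last, ← partialProd_last, Fin.partialProd_contractNth, Function.comp_apply,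
    Fin.succAbove_of_le_castSucc _ _
      (Nat.succ_le_of_lt j.2 : (j : ℕ) + 1 ≤ n + 1), Fin.succ_last]

lemma prod_update_init_eq_one_iff (a : Fin (n + 2) → Aff q) :
    (List.ofFn (Function.update (Fin.init a) 0 (a (Fin.last (n + 1)) * a 0))).prod = 1 ↔
      (List.ofFn a).prod = 1 := by
  have h1 := partialProd_update_init a (Fin.last n)
  have h2 : Fin.partialProd a (Fin.last (n + 2)) =
      Fin.partialProd a (Fin.last n).castSucc.succ * a (Fin.last (n + 1)) := by
    rw [← Fin.succ_last, Fin.partialProd_succ]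
    rfl
  rw [Fin.succ_last] at h1
  rw [← partialProd_last, ← partialProd_last, h1, h2, mul_eq_one_comm]

lemma isSingle_update_init {f : Fin (n + 2) → G.Algebra} {a : Fin (n + 2) → Aff q}
    (hf : ∀ j, (f j).IsSingle (a j)) (k : Fin (n + 1)) :
    (Function.update (Fin.init f) 0 (f (Fin.last (n + 1)) * f 0) k).IsSingle
      (Function.update (Fin.init a) 0 (a (Fin.last (n + 1)) * a 0) k) := by
  by_cases h : k = 0
  · subst h
    simpa using (hf _).mul (hf _)
  · simpa [h, Fin.init] using hf k.castSucc

/-- Moving the last factor of a path in front of the first one translates the functions that are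
read off along the path by the last arrow. -/
lemma pathFunction_update_init {f : Fin (n + 2) → G.Algebra} {a : Fin (n + 2) → Aff q}
    (hf : ∀ j, (f j).IsSingle (a j)) (ha : (List.ofFn a).prod = 1) :
    pathFunction (Function.update (Fin.init f) 0 (f (Fin.last (n + 1)) * f 0))
        (Function.update (Fin.init a) 0 (a (Fin.last (n + 1)) * a 0)) =
      fun j z => Function.update (Fin.init (pathFunction f a)) 0
        (pathFunction f a (Fin.last (n + 1)) * pathFunction f a 0) j
          ((a (Fin.last (n + 1)))⁻¹.shift z) := by
  funext j z
  rw [pathFunction, partialProd_update_init, mul_inv_rev, Aff.shift_mul]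
  by_cases h : j = 0
  · subst h
    have h1 : Fin.partialProd a (0 : Fin (n + 2)).succ = a 0 := by
      rw [Fin.partialProd_succ', Fin.partialProd_zero, mul_one]
    rw [Function.update_self, Function.update_self, Function.update_self,
      Algebra.val_mul_apply _ (hf _), mul_inv_cancel_right, Pi.mul_apply, pathFunction,
      pathFunction, Fin.succ_last, partialProd_last, ha, inv_one, Aff.shift_one, Fin.castSucc_zero,
      h1, Aff.shift_shift_inv]
  · rw [Function.update_of_ne h, Function.update_of_ne h, Function.update_of_ne h]
    rfl

lemma hochschild_weightedPsi {η : ℝ → ℂ} (hG : G.IsOriented) (hη : G.IsInvariantWeight η)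
    (f : Fin (q + 2) → G.Algebra) :
    (∑ j : Fin (q + 1), (-1) ^ (j : ℕ) * G.weightedPsi η (j.castSucc.contractNth (· * ·) f))
      + (-1) ^ (q + 1) * G.weightedPsi η
        (Function.update (Fin.init f) 0 (f (Fin.last (q + 1)) * f 0)) = 0 := by
  classical
  obtain ⟨m, hm⟩ := exists_multilinear_hochschild (G.weightedPsiMultilinear hη.continuous)
  refine (hm f).symm.trans (multilinear_eq_zero m (fun f a hf => (hm f).trans ?_) f)
  change (∑ j : Fin (q + 1), (-1) ^ (j : ℕ) *
      G.weightedPsi η (j.castSucc.contractNth (· * ·) f)) + (-1) ^ (q + 1) * G.weightedPsi η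
        (Function.update (Fin.init f) 0 (f (Fin.last (q + 1)) * f 0)) = 0
  simp only [weightedPsi_of_isSingle η (isSingle_contractNth hf _),
    weightedPsi_of_isSingle η (isSingle_update_init hf), prod_contractNth,
    prod_update_init_eq_one_iff]
  by_cases ha : (List.ofFn a).prod = 1
  · simp only [ha, if_true, pathFunction_contractNth hf, pathFunction_update_init hf ha]
    have hV := isTest_pathFunction f a
    rw [← hochschild_sliceIntegral hη.continuous hV]
    congr 2
    by_cases h0 : (f (Fin.last (q + 1))).val (a (Fin.last (q + 1))) = 0
    · have h1 := pathFunction_eq_zero h0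
      rw [sliceIntegral_eq_zero (k := 0), sliceIntegral_eq_zero (k := 0)]
      · simp [h1]
      · funext z
        simp [h1]
    · have h1 := (Algebra.isCarried _ h0).inv
      exact sliceIntegral_comp_shift _ (hG _ h1) (hη.2 _ h1)
        (IsTest.update (fun j => hV j.castSucc) 0 ((hV _).mul (hV _)))
  · simp only [ha, if_false]
    simp

/-- `ψ` with an invariant weight is a cyclic cocycle. -/
lemma isCyclicCocycle_weightedPsi {η : ℝ → ℂ} (hG : G.IsOriented) (hη : G.IsInvariantWeight η) :
    IsCyclicCocycle (G.weightedPsi η) where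
  multilinear := ⟨G.weightedPsiMultilinear hη.continuous, fun _ => rfl⟩
  cyclic := weightedPsi_rotate hG hη
  hochschild := hochschild_weightedPsi hG hη

end AffineGroupoid

/-! ### The centre of the multiplier algebra -/

/-- A central multiplier commutes with the left multiplications. -/
lemma Multiplier.left_mul_right {A : Type*} [NonUnitalRing A] [Module ℂ A] [IsScalarTower ℂ A A]
    [SMulCommClass ℂ A A] {g : Multiplier A} (hg : g ∈ Set.center (Multiplier A)) (a b : A) :
    g.left (a * b) = a * g.left b := by
  let m : Multiplier A :=
    { left := LinearMap.mulLeft ℂ a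
      right := LinearMap.mulRight ℂ a
      left_mul := fun b c => (mul_assoc a b c).symm
      right_mul := fun b c => mul_assoc b c a
      middle := fun b c => (mul_assoc b a c).symm }
  have h := congrArg (fun n : Multiplier A => n.left b) ((Set.mem_center_iff.1 hg).comm m).eq
  exact h

/-- An affine map is determined by its germ at any point. -/
lemma Aff.eq_of_eventuallyEq {A B : Aff q} {x : EuclideanSpace ℝ (Fin q)}
    (h : (A : EuclideanSpace ℝ (Fin q) → EuclideanSpace ℝ (Fin q)) =ᶠ[𝓝 x] B) : A = B := by
  have hd : ∀ C : Aff q, HasFDerivAt C (LinearMap.toContinuousLinearMap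
      (C.linear : EuclideanSpace ℝ (Fin q) →ₗ[ℝ] EuclideanSpace ℝ (Fin q))) x := fun C =>
    C.toContinuousAffineEquiv.toContinuousAffineMap.hasFDerivAt
  have hlin := (hd A).unique ((hd B).congr_of_eventuallyEq h)
  ext1 y
  have hv : ∀ C : Aff q, C y = C.linear (y - x) + C x := fun C => by
    have := C.map_vadd x (y - x)
    simpa using this
  have h1 : A.linear (y - x) = B.linear (y - x) := DFunLike.congr_fun hlin (y - x)
  rw [hv A, hv B, h1, h.self_of_nhds]

namespace AffineGroupoid

variable {G : AffineGroupoid q}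

lemma isOpen_sheet (A : Aff q) : IsOpen (G.sheet A) :=
  (G.isOpen_arrows A).preimage continuous_fst

lemma mem_sheet_one {z : EuclideanSpace ℝ (Fin q) × ℝ} : z ∈ G.sheet 1 ↔ z.1 ∈ G.base :=
  ⟨fun h => G.source_mem h, fun h => G.one_mem h⟩

lemma exists_testFunction {U : Set (EuclideanSpace ℝ (Fin q) × ℝ)}
    {z : EuclideanSpace ℝ (Fin q) × ℝ} (hU : U ∈ 𝓝 z) : ∃ φ : testFunctions U, φ.1 z = 1 := by
  obtain ⟨φ, h1, h2, h3, -, h4⟩ := exists_contDiff_tsupport_subset (n := ⊤) hU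
  refine ⟨⟨fun w => (φ w : ℂ), Complex.ofRealCLM.contDiff.comp h3,
    h2.comp_left (g := fun r : ℝ => (r : ℂ)) Complex.ofReal_zero, ?_⟩, by simp [h4]⟩
  refine (closure_mono fun w hw => ?_).trans h1
  exact fun h => hw (by simp [h])

lemma sheetFunction_one_mul (φ : testFunctions (G.sheet 1)) (f : G.Algebra) (A : Aff q)
    (z : EuclideanSpace ℝ (Fin q) × ℝ) :
    (sheetFunction 1 φ * f).val A z = φ.1 (A.shift z) * f.val A z := by
  rw [Algebra.val_mul, conv, finsum_eq_single _ A fun C hC => ?_]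
  · rw [mul_inv_cancel, val_sheetFunction]
  · rw [isSingle_sheetFunction 1 φ _ fun h => hC (mul_inv_eq_one.1 h).symm]
    simp

lemma Algebra.mul_apply_of_isSingle_one (f : G.Algebra) {g : G.Algebra} (hg : g.IsSingle 1)
    (A : Aff q) (z : EuclideanSpace ℝ (Fin q) × ℝ) :
    (f * g).val A z = f.val A z * g.val 1 z := by
  rw [f.val_mul_apply hg, inv_one, mul_one, Aff.shift_one]

lemma mul_sheetFunction_one (f : G.Algebra) (φ : testFunctions (G.sheet 1)) (A : Aff q)
    (z : EuclideanSpace ℝ (Fin q) × ℝ) :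
    (f * sheetFunction 1 φ).val A z = f.val A z * φ.1 z := by
  rw [f.mul_apply_of_isSingle_one (isSingle_sheetFunction 1 φ), val_sheetFunction]

lemma sheetFunction_one_comm (φ χ : testFunctions (G.sheet 1)) :
    sheetFunction 1 φ * sheetFunction 1 χ = sheetFunction 1 χ * sheetFunction 1 φ := by
  refine Algebra.val_injective (funext fun A => funext fun z => ?_)
  rw [sheetFunction_one_mul, mul_sheetFunction_one, mul_comm]
  by_cases h : A = 1
  · rw [h, Aff.shift_one]
  · simp [isSingle_sheetFunction 1 χ A h]

lemma Algebra.IsSingle.one_mul_apply {g : G.Algebra} (hg : g.IsSingle 1) (f : G.Algebra)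
    (A : Aff q) (z : EuclideanSpace ℝ (Fin q) × ℝ) :
    (g * f).val A z = g.val 1 (A.shift z) * f.val A z := by
  rw [Algebra.val_mul, conv, finsum_eq_single _ A fun C hC => ?_]
  · rw [mul_inv_cancel]
  · rw [hg _ fun h => hC (mul_inv_eq_one.1 h).symm]
    simp

/-- A central multiplier maps functions on the objects to functions on the objects. Commuting with
the functions on the objects forces the image to live on the isotropy, and an affine map different
from the identity has no interior fixed points. -/
lemma isSingle_central {L : G.Algebra →ₗ[ℂ] G.Algebra} (hl : ∀ a b, L (a * b) = L a * b)
    (hr : ∀ a b, L (a * b) = a * L b) (φ : testFunctions (G.sheet 1)) :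
    (L (sheetFunction 1 φ)).IsSingle 1 := by
  intro B hB
  set u := (L (sheetFunction 1 φ)).val B with hu
  have hfix : ∀ z, u z ≠ 0 → B.shift z = z := by
    intro z hz
    by_contra hne
    have hz1 : z ∈ G.sheet 1 := mem_sheet_one.2 (G.source_mem (Algebra.mem_arrows _ hz))
    obtain ⟨χ, hχ⟩ := exists_testFunction (z := z) (U := G.sheet 1 ∩ {B.shift z}ᶜ)
      (((isOpen_sheet 1).inter isOpen_compl_singleton).mem_nhds ⟨hz1, fun h => hne h.symm⟩)
    let χ' : testFunctions (G.sheet 1) :=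
      ⟨χ.1, χ.2.1, χ.2.2.1, χ.2.2.2.trans Set.inter_subset_left⟩
    have hχB : χ.1 (B.shift z) = 0 := by
      by_contra h
      exact (χ.2.2.2 (subset_tsupport _ h)).2 rfl
    have h := congrArg (fun f : G.Algebra => f.val B z)
      ((hr (sheetFunction 1 χ') (sheetFunction 1 φ)).symm.trans
        ((congrArg L (sheetFunction_one_comm χ' φ)).trans (hl _ _)))
    simp only [sheetFunction_one_mul, mul_sheetFunction_one] at h
    change χ.1 (B.shift z) * u z = u z * χ.1 z at h
    rw [hχB, hχ, zero_mul, mul_one] at h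
    exact hz h.symm
  funext z
  by_contra hz
  refine hB (Aff.eq_of_eventuallyEq (x := z.1) ?_)
  have hopen : IsOpen {z | u z ≠ 0} :=
    isOpen_ne_fun (Algebra.isTest _ B).1.continuous continuous_const
  have hev : ∀ᶠ x in 𝓝 z.1, u (x, z.2) ≠ 0 :=
    (Continuous.prodMk_left z.2).continuousAt.eventually (hopen.mem_nhds (x := z) hz)
  filter_upwards [hev] with x hx
  exact congrArg Prod.fst (hfix _ hx)

/-- A central multiplier is multiplication by a function `h` on the objects, which is continuous and
invariant under the groupoid. -/
lemma exists_central_function {L : G.Algebra →ₗ[ℂ] G.Algebra} (hl : ∀ a b, L (a * b) = L a * b)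
    (hr : ∀ a b, L (a * b) = a * L b) : ∃ h : EuclideanSpace ℝ (Fin q) × ℝ → ℂ,
    ContinuousOn h (G.sheet 1) ∧
    (∀ A x t, (A, x) ∈ G.arrows → h (A.shift (x, t)) = h (x, t)) ∧
    ∀ (f : G.Algebra) (A : Aff q) (z : EuclideanSpace ℝ (Fin q) × ℝ), (A.shift z).1 ∈ G.base →
      (L f).val A z = h (A.shift z) * f.val A z := by
  classical
  -- The value `h z` is read off from the image of a bump function that equals `1` at `z`.
  choose! φ hφ using fun (z : EuclideanSpace ℝ (Fin q) × ℝ) (hz : z ∈ G.sheet 1) =>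
    exists_testFunction ((isOpen_sheet 1).mem_nhds hz)
  let h : EuclideanSpace ℝ (Fin q) × ℝ → ℂ := fun z => (L (sheetFunction 1 (φ z))).val 1 z
  have hmul : ∀ (χ : testFunctions (G.sheet 1)) (z : EuclideanSpace ℝ (Fin q) × ℝ),
      z ∈ G.sheet 1 → (L (sheetFunction 1 χ)).val 1 z = χ.1 z * h z := by
    intro χ z hz
    have := congrArg (fun f : G.Algebra => f.val 1 z)
      ((hl (sheetFunction 1 χ) (sheetFunction 1 (φ z))).symm.trans (hr _ _))
    simp only [sheetFunction_one_mul, mul_sheetFunction_one, Aff.shift_one, hφ z hz,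
      mul_one] at this
    exact this
  have hleft : ∀ (f : G.Algebra) (A : Aff q) (z : EuclideanSpace ℝ (Fin q) × ℝ),
      (A.shift z).1 ∈ G.base → (L f).val A z = h (A.shift z) * f.val A z := by
    intro f A z hz
    have hz1 := mem_sheet_one.2 hz
    have := congrArg (fun f : G.Algebra => f.val A z)
      ((hr (sheetFunction 1 (φ (A.shift z))) f).symm.trans (hl _ _))
    simp only [sheetFunction_one_mul, (isSingle_central hl hr _).one_mul_apply, hφ _ hz1,
      hmul _ _ hz1, one_mul] at this
    exact this
  refine ⟨h, fun z hz => ContinuousAt.continuousWithinAt ?_, fun A x t hA => ?_, hleft⟩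
  · have h1 : ContinuousAt (fun w => (L (sheetFunction 1 (φ z))).val 1 w / (φ z).1 w) z :=
      (Algebra.isTest _ 1).1.continuous.continuousAt.div (φ z).2.1.continuous.continuousAt
        (by rw [hφ z hz]; exact one_ne_zero)
    refine h1.congr ?_
    have h2 : ∀ᶠ w in 𝓝 z, (φ z).1 w ≠ 0 :=
      (φ z).2.1.continuous.continuousAt.eventually_ne (by rw [hφ z hz]; exact one_ne_zero)
    filter_upwards [h2, (isOpen_sheet 1).mem_nhds hz] with w hw hw1
    rw [hmul _ _ hw1, mul_div_cancel_left₀ _ hw]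
  · have hz1 : (x, t) ∈ G.sheet 1 := mem_sheet_one.2 (G.source_mem hA)
    obtain ⟨χ, hχ⟩ := exists_testFunction ((isOpen_sheet A).mem_nhds
      (show (x, t) ∈ G.sheet A from hA))
    have h1 := hleft (sheetFunction A χ) A (x, t) (G.range_mem hA)
    have h2 := congrArg (fun f : G.Algebra => f.val A (x, t))
      ((hl (sheetFunction A χ) (sheetFunction 1 (φ (x, t)))).symm.trans (hr _ _))
    simp only [mul_sheetFunction_one, hφ _ hz1, mul_one, hmul _ _ hz1, one_mul,
      Algebra.mul_apply_of_isSingle_one _ (isSingle_central hl hr _), val_sheetFunction,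
      hχ] at h1 h2
    exact h1.symm.trans h2

/-! ### Ergodicity -/

/-- A continuous invariant function on the objects of `G ⋊ ℝ` depends on the second coordinate
only: on each slice it is invariant under the unimodular part, and two different values would be
separated by disjoint open sets, whose preimages are invariant, non-null and disjoint. -/
lemma UnimodularErgodic.eq_of_mem_base (hG : G.UnimodularErgodic)
    {h : EuclideanSpace ℝ (Fin q) × ℝ → ℂ} (hc : ContinuousOn h (G.sheet 1))
    (hinv : ∀ A x t, (A, x) ∈ G.arrows → h (A.shift (x, t)) = h (x, t)) (t : ℝ)
    {x y : EuclideanSpace ℝ (Fin q)} (hx : x ∈ G.base) (hy : y ∈ G.base) : h (x, t) = h (y, t) := by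
  by_contra hne
  obtain ⟨U, V, hU, hV, hxU, hyV, hUV⟩ := t2_separation hne
  have hct : ContinuousOn (fun x => h (x, t)) G.base :=
    hc.comp (f := fun x => (x, t)) (Continuous.prodMk_left t).continuousOn
      fun x hx => mem_sheet_one.2 hx
  have hopen : ∀ W : Set ℂ, IsOpen W → IsOpen (G.base ∩ (fun x => h (x, t)) ⁻¹' W) := fun W hW =>
    hct.isOpen_inter_preimage G.isOpen_base hW
  rcases hG _ (hopen U hU).measurableSet Set.inter_subset_left (fun A z hA hδ => by
    have h1 : A.shift (z, t) = (A z, t) := by simp [Aff.shift, hδ]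
    have h2 := hinv A z t hA
    rw [h1] at h2
    simp [G.source_mem hA, G.range_mem hA, h2]) with h0 | h0
  · exact ((hopen U hU).measure_pos volume ⟨x, hx, hxU⟩).ne' h0
  · refine ((hopen V hV).measure_pos volume ⟨y, hy, hyV⟩).ne' (measure_mono_null ?_ h0)
    exact fun z hz => ⟨hz.1, fun hz' => Set.disjoint_left.1 hUV hz'.2 hz.2⟩

/-- Invariance under all of `G` turns into invariance of the weight under the translations by
`log δ(γ)`. -/
lemma UnimodularErgodic.exists_weight (hG : G.UnimodularErgodic)
    {h : EuclideanSpace ℝ (Fin q) × ℝ → ℂ} (hc : ContinuousOn h (G.sheet 1))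
    (hinv : ∀ A x t, (A, x) ∈ G.arrows → h (A.shift (x, t)) = h (x, t)) :
    ∃ η : ℝ → ℂ, G.IsInvariantWeight η ∧ ∀ x ∈ G.base, ∀ t, h (x, t) = η t := by
  rcases G.base.eq_empty_or_nonempty with h0 | ⟨y, hy⟩
  · exact ⟨fun _ => 0, ⟨continuous_const, fun _ _ _ => rfl⟩, fun x hx => by simp [h0] at hx⟩
  · refine ⟨fun t => h (y, t), ⟨?_, ?_⟩, fun x hx t => hG.eq_of_mem_base hc hinv t hx hy⟩
    · exact hc.comp_continuous (Continuous.prodMk_right y) fun t => mem_sheet_one.2 hy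
    · rintro A ⟨x, hA⟩ t
      rw [hG.eq_of_mem_base hc hinv _ hy (G.range_mem hA),
        hG.eq_of_mem_base hc hinv t hy (G.source_mem hA)]
      exact hinv A x t hA

/-! ### The cocycle `ψ` is anabelian -/

/-- Multiplying `f⁰` by `η` at the range of its argument multiplies the form by `η(t)`, because the
range of `γ₀` is the base point `(x, t)` of the path. -/
lemma formCoeff_update_zero {f : Fin (q + 1) → G.Algebra} {g : G.Algebra} {η : ℝ → ℂ}
    (hg : ∀ A x t, (A.shift (x, t)).1 ∈ G.base → g.val A (x, t) =
      η (A.shift (x, t)).2 * (f 0).val A (x, t)) {a : Fin (q + 1) → Aff q}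
    (ha : (List.ofFn a).prod = 1) (t : ℝ) {x : EuclideanSpace ℝ (Fin q)} (hx : x ∈ G.base) :
    formCoeff (Function.update f 0 g) a t x = η t * formCoeff f a t x := by
  have h1 : (a 0).shift ((tail a 0).shift (x, t)) = (x, t) := by
    have : a 0 * tail a 0 = 1 := by
      rw [← ha, List.ofFn_succ, List.prod_cons]
      simp [tail]
    rw [← Aff.shift_mul, this, Aff.shift_one]
  have h2 := hg (a 0) ((tail a 0).shift (x, t)).1 ((tail a 0).shift (x, t)).2
    (by rw [Prod.mk.eta, h1]; exact hx)
  rw [Prod.mk.eta, h1] at h2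
  have h3 : ∀ j : Fin q, pullback (Function.update f 0 g) a t j.succ = pullback f a t j.succ :=
    fun j => by
      funext x
      simp [pullback]
  have h4 : pullback (Function.update f 0 g) a t 0 x = η t * pullback f a t 0 x := by
    simpa [pullback] using h2
  simp only [formCoeff, h3, h4, mul_assoc]

lemma psi_eq_weightedPsi (f : Fin (q + 1) → G.Algebra) :
    G.psi f = G.weightedPsi (fun _ => 1) f := by
  rw [weightedPsi_eq_integral continuous_const, psi]
  simp

lemma isAnabelian_psi (hor : G.IsOriented) (hG : G.UnimodularErgodic) : IsAnabelian G.psi where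
  isCyclicCocycle := by
    rw [show G.psi = G.weightedPsi fun _ => 1 from funext psi_eq_weightedPsi]
    exact isCyclicCocycle_weightedPsi hor ⟨continuous_const, fun _ _ _ => rfl⟩
  twist := fun g hg => by
    obtain ⟨h, hc, hinv, hmul⟩ := exists_central_function g.left_mul (Multiplier.left_mul_right hg)
    obtain ⟨η, hη, hηh⟩ := hG.exists_weight hc hinv
    suffices hpsi : TransAffine.twist G.psi g = G.weightedPsi η by
      rw [hpsi]
      exact isCyclicCocycle_weightedPsi hor hη
    funext f
    rw [TransAffine.twist, psi, weightedPsi_eq_integral hη.continuous]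
    congr 1
    funext t
    rw [← integral_const_mul]
    refine setIntegral_congr_fun G.isOpen_base.measurableSet fun x hx => ?_
    rw [← smul_eq_mul, smul_finsum]
    refine finsum_congr fun a => ?_
    rw [smul_eq_mul]
    refine formCoeff_update_zero (fun A x t hx => ?_) a.2 t hx
    rw [hmul _ _ _ hx, ← hηh _ hx]

end AffineGroupoid

lemma Foliation.Transversal.isOriented_groupoid {p : ℕ} {M : Type*} [TopologicalSpace M]
    [ChartedSpace (EuclideanSpace ℝ (Fin (p + q))) M] {F : Foliation p q M} {𝒰 : F.AffineAtlas}
    (T : Foliation.Transversal 𝒰) : T.groupoid.IsOriented := by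
  rintro A ⟨x, hA⟩
  obtain ⟨B, hB, hAB⟩ := Foliation.Transversal.IsHolonomyGerm.exists_affine hA
  rwa [show A = B from Aff.eq_of_eventuallyEq hAB]

end TransAffine
end

theorem mainTheorem5 {p q : ℕ} {M : Type*} [TopologicalSpace M] [T2Space M]
    [SecondCountableTopology M] [ChartedSpace (EuclideanSpace ℝ (Fin (p + q))) M]
    [IsManifold (modelWithCornersSelf ℝ (EuclideanSpace ℝ (Fin (p + q)))) ∞ M]
    (F : TransAffine.Foliation p q M) (𝒰 : F.AffineAtlas)
    (T : TransAffine.Foliation.Transversal 𝒰)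
    (hT : T.groupoid.UnimodularErgodic) :
    TransAffine.IsAnabelian T.groupoid.psi :=
  TransAffine.AffineGroupoid.isAnabelian_psi T.isOriented_groupoid hT
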